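/- Let $d,n\ge 1$ be integers and let $K\subset\mathbb{R}^n$ be compact. "Measure" means positive finite Borel measure. For measures $\mu,\nu$ on $K$ put $$I(\mu,\nu)=\iint\log\frac{1}{|x-y|}\,d\mu(x)\,d\nu(y)\in\mathbb{R}\cup\{+\infty\},\qquad I(\mu)=I(\mu,\mu),$$ where $|\cdot|$ is the Euclidean norm and the kernel is $+\infty$ for $x=y$. A set $A\subset K$ has positive capacity if some compact subset of $A$ carries a nonzero measure $\mu$ with $I(\mu)<+\infty$. For $m>0$ let $\mathcal{M}_m(K)$ be the set of measures on $K$ of total mass $m$, with the weak topology (duality with the continuous functions on $K$); finite products of such sets carry the product topology. Let $C=(c_{ij})$ be a real symmetric positive definite $d\times d$ matrix, let $V_1,\dots,V_d:K\to\mathbb{R}\cup\{+\infty\}$ be lower semicontinuous functions, each finite on a set of positive capacity, and let $m_1,\dots,m_d>0$. Define $$J_0(\mu_1,\dots,\mu_d)=\begin{cases}\displaystyle\sum_{i,j=1}^d c_{ij}I(\mu_i,\mu_j)&\text{if } I(\mu_i)<+\infty\text{ for all } i,\\ +\infty&\text{otherwise,}\end{cases}$$ $$J_V(\mu_1,\dots,\mu_d)=J_0(\mu_1,\dots,\mu_d)+\sum_{i=1}^d\int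 V_i\,d\mu_i .$$ Then $\mathcal{M}_{m_1}(K)\times\cdots\times\mathcal{M}_{m_d}(K)$ is compact, and on it $J_V$ takes values in $\mathbb{R}\cup\{+\infty\}$, is lower semicontinuous, and is strictly convex on the (convex) set where it is finite. Moreover $J_V$ has a unique minimizer on $\mathcal{M}_{m_1}(K)\times\cdots\times\mathcal{M}_{m_d}(K)$, and also a unique minimizer on every closed convex subset of $\mathcal{M}_{m_1}(K)\times\cdots\times\mathcal{M}_{m_d}(K)$ that contains at least one element where $J_V$ is finite. -/

import Mathlib

open MeasureTheory Set
open scoped NNReal ENNReal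

noncomputable section

/-- The integral `∫ f dμ` of an extended-real function, as an extended real number: the integral
of the positive part minus the integral of the negative part. It is the usual integral whenever
at least one of the two is finite. -/
def extIntegral {X : Type*} [MeasurableSpace X] (μ : Measure X) (f : X → EReal) : EReal :=
  ((∫⁻ x, (f x).toENNReal ∂μ : ℝ≥0∞) : EReal) - ((∫⁻ x, (-f x).toENNReal ∂μ : ℝ≥0∞) : EReal)

/-- The logarithmic kernel `log (1 / |x - y|)`, with value `+∞` on the diagonal
(in `ℝ≥0∞` one has `0⁻¹ = ∞`, and `ENNReal.log ∞ = ⊤`). -/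
def logKernel {X : Type*} [PseudoEMetricSpace X] (x y : X) : EReal :=
  ENNReal.log (edist x y)⁻¹

/-- The mutual logarithmic energy `I(μ, ν) = ∬ log (1 / |x - y|) dμ(x) dν(y)`. -/
def mutualEnergy {X : Type*} [PseudoEMetricSpace X] [MeasurableSpace X]
    (μ ν : FiniteMeasure X) : EReal :=
  extIntegral ((μ : Measure X).prod (ν : Measure X)) (fun p => logKernel p.1 p.2)

/-- The logarithmic energy `I(μ) = I(μ, μ)`. -/
def logEnergy {X : Type*} [PseudoEMetricSpace X] [MeasurableSpace X]
    (μ : FiniteMeasure X) : EReal :=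
  mutualEnergy μ μ

/-- A set has positive capacity if some compact subset of it carries a nonzero finite measure
of finite logarithmic energy. -/
def HasPositiveCapacity {X : Type*} [PseudoEMetricSpace X] [MeasurableSpace X]
    (A : Set X) : Prop :=
  ∃ E : Set X, E ⊆ A ∧ IsCompact E ∧
    ∃ μ : FiniteMeasure X, μ ≠ 0 ∧ (μ : Measure X) Eᶜ = 0 ∧ logEnergy μ < ⊤

/-- The set `M_m(X)` of finite measures on `X` of total mass `m`. -/
def measuresOfMass (X : Type*) [MeasurableSpace X] (m : ℝ≥0) : Set (FiniteMeasure X) :=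
  {μ | μ.mass = m}

/-- The product `M_{m_1}(X) × ⋯ × M_{m_d}(X)`. -/
def vectorMeasures (X : Type*) [MeasurableSpace X] {d : ℕ} (m : Fin d → ℝ≥0) :
    Set (Fin d → FiniteMeasure X) :=
  {μ | ∀ i, μ i ∈ measuresOfMass X (m i)}

open Classical in
/-- The functional `J₀`: it is `∑ c_ij I(μ_i, μ_j)` if all `I(μ_i)` are `< +∞`,
and `+∞` otherwise. -/
def energyJ0 {X : Type*} [PseudoEMetricSpace X] [MeasurableSpace X] {d : ℕ}
    (C : Matrix (Fin d) (Fin d) ℝ) (μ : Fin d → FiniteMeasure X) : EReal :=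
  if ∀ i, logEnergy (μ i) < ⊤ then
    ∑ i, ∑ j, ((C i j : ℝ) : EReal) * mutualEnergy (μ i) (μ j)
  else ⊤

/-- The functional `J_V = J₀ + ∑ ∫ V_i dμ_i`. -/
def energyJV {X : Type*} [PseudoEMetricSpace X] [MeasurableSpace X] {d : ℕ}
    (C : Matrix (Fin d) (Fin d) ℝ) (V : Fin d → X → EReal)
    (μ : Fin d → FiniteMeasure X) : EReal :=
  energyJ0 C μ + ∑ i, extIntegral (μ i : Measure X) (V i)

end

set_option linter.unusedSectionVars false

/-! The difficulty is that off-diagonal entries of `C` may be negative and the logarithmic kernel is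
unbounded, so neither lower semicontinuity nor convexity can be read off the individual mutual
energies. The kernel is therefore replaced by k_ε = -½ log(ε + |x - y|²), which is continuous and
increases to log(1/|x - y|) as ε decreases to 0.

For ε < δ, k_ε - k_δ is half the integral over s in (ε, δ] of (s + |x - y|²)⁻¹. This is a Laplace
integral of Gaussians exp(-t|x - y|²), and each Gaussian is a positive mixture of cosines cos⟨x - y,
ξ⟩. A cosine kernel turns the form of a positive semidefinite matrix into values of that matrix at
cosine and sine transforms, so the whole form at k_ε - k_δ is nonnegative
(`kernelForm_regKernel_sub_nonneg`). Hence the regularized vector energy increases as ε decreases,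
whatever the signs of the entries.

Approximating each V_i from below by continuous functions as well, J_V becomes the supremum of an
increasing sequence of real functionals, continuous at vectors of nonzero measures
(`tendsto_regJV`). This gives lower semicontinuity and excludes -∞. That the limit is +∞ when some
I(μ_i) is infinite follows because C - cI is positive semidefinite for some c > 0
(`tendsto_energyJ0`).

On a segment from μ to ν, the regularized functional is affine minus ab times the form of C at μ -
ν. For equal masses this form is at least its value at the fixed kernel k_1 - k_2 (`energyGap_le`),
a bound independent of the regularization. It is positive for μ ≠ ν because characteristic functions
determine measures (`energyGap_pos`). Passing to the limit yields strict convexity without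
subtracting infinite quantities. Compactness then gives existence of minimizers, strict convexity
gives uniqueness, and positive capacity supplies a point of finite energy (`exists_finite_energy`).
-/

/-- The bilinear form `∑ A_ab ∬ k dμ_a dμ_b` attached to a kernel `k`. -/
noncomputable def kernelForm {X ι : Type*} [MeasurableSpace X] [Fintype ι] (A : ι → ι → ℝ)
    (μ : ι → FiniteMeasure X) (k : X × X → ℝ) : ℝ :=
  ∑ a, ∑ b, A a b * ∫ p, k p ∂((μ a : Measure X).prod (μ b : Measure X))

/-! ### Forms of mixtures of kernels (Fubini) -/

section Mixture

variable {X ι T : Type*} [MeasurableSpace X] [Fintype ι] [MeasurableSpace T]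

lemma integrable_kernelForm (A : ι → ι → ℝ) (μ : ι → FiniteMeasure X) (τ : Measure T) [SFinite τ]
    (h : T → X × X → ℝ)
    (hint : ∀ a b, Integrable (fun q : (X × X) × T => h q.2 q.1)
      (((μ a : Measure X).prod (μ b : Measure X)).prod τ)) :
    Integrable (fun t => kernelForm A μ (h t)) τ := by
  unfold kernelForm
  refine integrable_finsetSum _ fun a _ => integrable_finsetSum _ fun b _ => ?_
  exact (hint a b).integral_prod_right.const_mul _

lemma kernelForm_integral (A : ι → ι → ℝ) (μ : ι → FiniteMeasure X) (τ : Measure T) [SFinite τ]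
    (h : T → X × X → ℝ)
    (hint : ∀ a b, Integrable (fun q : (X × X) × T => h q.2 q.1)
      (((μ a : Measure X).prod (μ b : Measure X)).prod τ)) :
    kernelForm A μ (fun p => ∫ t, h t p ∂τ) = ∫ t, kernelForm A μ (h t) ∂τ := by
  unfold kernelForm
  rw [integral_finsetSum _ fun a _ => integrable_finsetSum _ fun b _ =>
    (hint a b).integral_prod_right.const_mul _]
  refine Finset.sum_congr rfl fun a _ => ?_
  rw [integral_finsetSum _ fun b _ => (hint a b).integral_prod_right.const_mul _]
  refine Finset.sum_congr rfl fun b _ => ?_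
  rw [integral_const_mul, integral_integral_swap (hint a b)]

lemma kernelForm_const_mul (A : ι → ι → ℝ) (μ : ι → FiniteMeasure X) (c : ℝ) (k : X × X → ℝ) :
    kernelForm A μ (fun p => c * k p) = c * kernelForm A μ k := by
  simp only [kernelForm, integral_const_mul, Finset.mul_sum]
  exact Finset.sum_congr rfl fun a _ => Finset.sum_congr rfl fun b _ => by ring

lemma kernelForm_sub (A : ι → ι → ℝ) (μ : ι → FiniteMeasure X) {k l : X × X → ℝ}
    (hk : ∀ a b, Integrable k ((μ a : Measure X).prod (μ b : Measure X)))
    (hl : ∀ a b, Integrable l ((μ a : Measure X).prod (μ b : Measure X))) :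
    kernelForm A μ (fun p => k p - l p) = kernelForm A μ k - kernelForm A μ l := by
  simp only [kernelForm, ← Finset.sum_sub_distrib, ← mul_sub]
  exact Finset.sum_congr rfl fun a _ => Finset.sum_congr rfl fun b _ => by
    rw [integral_sub (hk a b) (hl a b)]

end Mixture

/-- Supplies the joint integrability for the Fubini steps: since `P` is finite, a bound depending on
the mixture parameter alone suffices. -/
lemma integrable_of_abs_le_snd {Y T : Type*} [TopologicalSpace Y] [MeasurableSpace Y]
    [OpensMeasurableSpace Y] [TopologicalSpace T] [MeasurableSpace T] [OpensMeasurableSpace T]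
    [SecondCountableTopology Y] [SecondCountableTopology T]
    (P : Measure Y) [IsFiniteMeasure P] (τ : Measure T) [SFinite τ] {f : Y × T → ℝ}
    (hf : AEStronglyMeasurable f (P.prod τ)) {g : T → ℝ} (hg : Integrable g τ)
    (hfg : ∀ᵐ t ∂τ, ∀ y, |f (y, t)| ≤ g t) : Integrable f (P.prod τ) := by
  refine (hg.comp_snd P).mono' hf ?_
  have h := (Measure.quasiMeasurePreserving_snd (μ := P) (ν := τ)).ae hfg
  filter_upwards [h] with q hq
  exact hq q.1

/-! ### Fourier transform of the Gaussian -/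

section Fourier

open Real

variable {E : Type*} [NormedAddCommGroup E] [InnerProductSpace ℝ E] [FiniteDimensional ℝ E]
  [MeasurableSpace E] [BorelSpace E]

lemma integrable_exp_neg_mul_norm_sq {b : ℝ} (hb : 0 < b) :
    Integrable (fun v : E => Real.exp (-b * ‖v‖ ^ 2)) := by
  have h := (GaussianFourier.integrable_cexp_neg_mul_sq_norm_add (V := E) (b := (b : ℂ))
    (by simpa using hb) 0 0).norm
  refine h.congr (ae_of_all _ fun v => ?_)
  simp only [Complex.norm_exp]
  congr 1
  simp [← Complex.ofReal_pow]

lemma integral_exp_neg_mul_norm_sq_pos {b : ℝ} (hb : 0 < b) :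
    0 < ∫ v : E, Real.exp (-b * ‖v‖ ^ 2) :=
  integral_exp_pos (integrable_exp_neg_mul_norm_sq hb)

/-- Real part of the complex Gaussian integral with linear term i⟨w, v⟩. -/
lemma integral_exp_mul_cos_inner {b : ℝ} (hb : 0 < b) (w : E) :
    ∫ v : E, Real.exp (-b * ‖v‖ ^ 2) * Real.cos (inner ℝ w v) =
      (∫ v : E, Real.exp (-b * ‖v‖ ^ 2)) * Real.exp (-‖w‖ ^ 2 / (4 * b)) := by
  have hb' : 0 < (b : ℂ).re := by simpa using hb
  have h1 := GaussianFourier.integral_cexp_neg_mul_sq_norm_add (V := E) hb' Complex.I w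
  have h0 := GaussianFourier.integral_cexp_neg_mul_sq_norm (V := E) hb'
  have hi := GaussianFourier.integrable_cexp_neg_mul_sq_norm_add (V := E) hb' Complex.I w
  rw [← h0] at h1
  have hc : (∫ v : E, Complex.exp (-(b : ℂ) * (‖v‖ : ℂ) ^ 2)) =
      ((∫ v : E, Real.exp (-b * ‖v‖ ^ 2) : ℝ) : ℂ) := by
    rw [← integral_complex_ofReal]
    congr 1; ext v; push_cast; rfl
  have he : Complex.exp (Complex.I ^ 2 * (‖w‖ : ℂ) ^ 2 / (4 * (b : ℂ))) =
      ((Real.exp (-‖w‖ ^ 2 / (4 * b)) : ℝ) : ℂ) := by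
    push_cast; congr 1; rw [Complex.I_sq]; ring
  rw [hc, he, ← Complex.ofReal_mul] at h1
  have h2 := congrArg Complex.re h1
  rw [Complex.ofReal_re] at h2
  rw [← h2]
  have h3 := integral_re hi
  simp only [RCLike.re_eq_complex_re] at h3
  rw [← h3]
  congr 1; ext v
  rw [Complex.exp_re]
  congr 2
  · simp [← Complex.ofReal_pow]
  · simp [← Complex.ofReal_pow]

end Fourier

/-! ### Conditional positivity: from cosines to Gaussians, resolvents and logarithms -/

section PositiveDefinite

variable {E : Type*} [NormedAddCommGroup E] [InnerProductSpace ℝ E] [MeasurableSpace E]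
  [BorelSpace E] [FiniteDimensional ℝ E] {K : Set E} {ι : Type*} [Fintype ι]

/-- The quadratic form of `A` at the cosine and sine transforms of `μ` at frequency `ξ`. -/
noncomputable def frequencyForm (A : ι → ι → ℝ) (μ : ι → FiniteMeasure K) (ξ : E) : ℝ :=
  ∑ a, ∑ b, A a b *
    ((∫ x, Real.cos (inner ℝ ξ (x : E)) ∂(μ a : Measure K)) *
        (∫ x, Real.cos (inner ℝ ξ (x : E)) ∂(μ b : Measure K)) +
      (∫ x, Real.sin (inner ℝ ξ (x : E)) ∂(μ a : Measure K)) *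
        (∫ x, Real.sin (inner ℝ ξ (x : E)) ∂(μ b : Measure K)))

lemma frequencyForm_nonneg {A : ι → ι → ℝ} (hA : ∀ x : ι → ℝ, 0 ≤ ∑ a, ∑ b, A a b * (x a * x b))
    (μ : ι → FiniteMeasure K) (ξ : E) : 0 ≤ frequencyForm A μ ξ := by
  simp only [frequencyForm, mul_add, Finset.sum_add_distrib]
  exact add_nonneg (hA _) (hA _)

lemma integrable_cos_inner (μ : FiniteMeasure K) (ξ : E) :
    Integrable (fun x : K => Real.cos (inner ℝ ξ (x : E))) (μ : Measure K) := by
  refine Integrable.of_bound (C := 1) (by fun_prop) (ae_of_all _ fun x => ?_)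
  exact Real.abs_cos_le_one _

lemma integrable_sin_inner (μ : FiniteMeasure K) (ξ : E) :
    Integrable (fun x : K => Real.sin (inner ℝ ξ (x : E))) (μ : Measure K) := by
  refine Integrable.of_bound (C := 1) (by fun_prop) (ae_of_all _ fun x => ?_)
  exact Real.abs_sin_le_one _

lemma continuous_integral_cos_inner (μ : FiniteMeasure K) :
    Continuous fun ξ : E => ∫ x, Real.cos (inner ℝ ξ (x : E)) ∂(μ : Measure K) := by
  refine continuous_of_dominated (bound := fun _ => 1) (fun ξ => by fun_prop)
    (fun ξ => ae_of_all _ fun x => Real.abs_cos_le_one _) (integrable_const _)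
    (ae_of_all _ fun x => by fun_prop)

lemma continuous_integral_sin_inner (μ : FiniteMeasure K) :
    Continuous fun ξ : E => ∫ x, Real.sin (inner ℝ ξ (x : E)) ∂(μ : Measure K) := by
  refine continuous_of_dominated (bound := fun _ => 1) (fun ξ => by fun_prop)
    (fun ξ => ae_of_all _ fun x => Real.abs_sin_le_one _) (integrable_const _)
    (ae_of_all _ fun x => by fun_prop)

lemma continuous_frequencyForm (A : ι → ι → ℝ) (μ : ι → FiniteMeasure K) :
    Continuous (frequencyForm A μ) := by
  have hc := fun a => continuous_integral_cos_inner (μ a)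
  have hs := fun a => continuous_integral_sin_inner (μ a)
  unfold frequencyForm
  exact continuous_finsetSum _ fun a _ => continuous_finsetSum _ fun b _ =>
    (((hc a).mul (hc b)).add ((hs a).mul (hs b))).const_mul _

/-- The addition formula for cos(α - β) splits the kernel into two products of functions of one
variable. -/
lemma kernelForm_cos_inner (A : ι → ι → ℝ) (μ : ι → FiniteMeasure K) (ξ : E) :
    kernelForm A μ (fun p => Real.cos (inner ℝ ((p.1 : E) - p.2) ξ)) = frequencyForm A μ ξ := by
  unfold kernelForm frequencyForm
  refine Finset.sum_congr rfl fun a _ => Finset.sum_congr rfl fun b _ => ?_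
  congr 1
  have h : ∀ p : K × K, Real.cos (inner ℝ ((p.1 : E) - p.2) ξ) =
      Real.cos (inner ℝ ξ (p.1 : E)) * Real.cos (inner ℝ ξ (p.2 : E)) +
      Real.sin (inner ℝ ξ (p.1 : E)) * Real.sin (inner ℝ ξ (p.2 : E)) := fun p => by
    rw [real_inner_comm, inner_sub_right, Real.cos_sub]
  simp only [h]
  rw [integral_add, integral_prod_mul (μ := (μ a : Measure K)) (ν := (μ b : Measure K))
      (fun x : K => Real.cos (inner ℝ ξ (x : E))) (fun x : K => Real.cos (inner ℝ ξ (x : E))),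
    integral_prod_mul (μ := (μ a : Measure K)) (ν := (μ b : Measure K))
      (fun x : K => Real.sin (inner ℝ ξ (x : E))) (fun x : K => Real.sin (inner ℝ ξ (x : E)))]
  · exact (integrable_cos_inner (μ a) ξ).mul_prod (integrable_cos_inner (μ b) ξ)
  · exact (integrable_sin_inner (μ a) ξ).mul_prod (integrable_sin_inner (μ b) ξ)

lemma exp_neg_mul_dist_sq_eq_integral {t : ℝ} (ht : 0 < t) (p : K × K) :
    (∫ v : E, Real.exp (-(4 * t)⁻¹ * ‖v‖ ^ 2)) * Real.exp (-t * dist p.1 p.2 ^ 2) =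
      ∫ v : E, Real.exp (-(4 * t)⁻¹ * ‖v‖ ^ 2) * Real.cos (inner ℝ ((p.1 : E) - p.2) v) := by
  rw [integral_exp_mul_cos_inner (by positivity), Subtype.dist_eq, dist_eq_norm]
  congr 2
  field_simp

/-- The variance (4t)⁻¹ is chosen so that the Fourier transform is exp(-t|x - y|²). The Gaussian
mass stays unevaluated, since only its positivity matters. -/
lemma kernelForm_gaussian (A : ι → ι → ℝ) (μ : ι → FiniteMeasure K) {t : ℝ} (ht : 0 < t) :
    Integrable (fun v : E => Real.exp (-(4 * t)⁻¹ * ‖v‖ ^ 2) * frequencyForm A μ v) ∧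
    (∫ v : E, Real.exp (-(4 * t)⁻¹ * ‖v‖ ^ 2)) *
        kernelForm A μ (fun p => Real.exp (-t * dist p.1 p.2 ^ 2)) =
      ∫ v : E, Real.exp (-(4 * t)⁻¹ * ‖v‖ ^ 2) * frequencyForm A μ v := by
  have hint : ∀ a b, Integrable (fun q : (K × K) × E =>
      Real.exp (-(4 * t)⁻¹ * ‖q.2‖ ^ 2) * Real.cos (inner ℝ ((q.1.1 : E) - q.1.2) q.2))
      (((μ a : Measure K).prod (μ b : Measure K)).prod volume) := fun a b => by
    refine integrable_of_abs_le_snd _ _ (Continuous.aestronglyMeasurable (by fun_prop))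
      (integrable_exp_neg_mul_norm_sq (E := E) (b := (4 * t)⁻¹) (by positivity))
      (ae_of_all _ fun v p => ?_)
    rw [abs_mul, abs_of_pos (Real.exp_pos _)]
    exact mul_le_of_le_one_right (Real.exp_pos _).le (Real.abs_cos_le_one _)
  have h1 := integrable_kernelForm A μ (volume : Measure E) (fun v p =>
    Real.exp (-(4 * t)⁻¹ * ‖v‖ ^ 2) * Real.cos (inner ℝ ((p.1 : E) - p.2) v)) hint
  have h2 := kernelForm_integral A μ (volume : Measure E) (fun v p =>
    Real.exp (-(4 * t)⁻¹ * ‖v‖ ^ 2) * Real.cos (inner ℝ ((p.1 : E) - p.2) v)) hint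
  simp only [kernelForm_const_mul, kernelForm_cos_inner] at h1 h2
  refine ⟨h1, ?_⟩
  rw [← h2, ← kernelForm_const_mul]
  congr 1; ext p
  exact exp_neg_mul_dist_sq_eq_integral ht p

lemma kernelForm_gaussian_nonneg {A : ι → ι → ℝ}
    (hA : ∀ x : ι → ℝ, 0 ≤ ∑ a, ∑ b, A a b * (x a * x b))
    (μ : ι → FiniteMeasure K) {t : ℝ} (ht : 0 < t) :
    0 ≤ kernelForm A μ (fun p => Real.exp (-t * dist p.1 p.2 ^ 2)) := by
  refine (mul_nonneg_iff_of_pos_left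
    (integral_exp_neg_mul_norm_sq_pos (E := E) (b := (4 * t)⁻¹) (by positivity))).1 ?_
  rw [(kernelForm_gaussian A μ ht).2]
  exact integral_nonneg fun v => mul_nonneg (Real.exp_pos _).le (frequencyForm_nonneg hA μ v)

/-- The frequency integrand is continuous and nonnegative, so being nonzero at one ξ makes it
positive on a nonempty open set. -/
lemma kernelForm_gaussian_pos {A : ι → ι → ℝ}
    (hA : ∀ x : ι → ℝ, 0 ≤ ∑ a, ∑ b, A a b * (x a * x b))
    (μ : ι → FiniteMeasure K) {ξ : E} (hξ : frequencyForm A μ ξ ≠ 0) {t : ℝ} (ht : 0 < t) :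
    0 < kernelForm A μ (fun p => Real.exp (-t * dist p.1 p.2 ^ 2)) := by
  refine (mul_pos_iff_of_pos_left
    (integral_exp_neg_mul_norm_sq_pos (E := E) (b := (4 * t)⁻¹) (by positivity))).1 ?_
  obtain ⟨h1, h2⟩ := kernelForm_gaussian A μ ht
  rw [h2, integral_pos_iff_support_of_nonneg
    (fun v => mul_nonneg (Real.exp_pos _).le (frequencyForm_nonneg hA μ v)) h1]
  have hc : Continuous fun v : E => Real.exp (-(4 * t)⁻¹ * ‖v‖ ^ 2) * frequencyForm A μ v :=
    Continuous.mul (by fun_prop) (continuous_frequencyForm A μ)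
  exact (hc.isOpen_support).measure_pos _ ⟨ξ, mul_ne_zero (Real.exp_pos _).ne' hξ⟩

lemma inv_add_sq_eq_integral {s : ℝ} (hs : 0 < s) (a : ℝ) (ha : 0 ≤ a) :
    (s + a)⁻¹ = ∫ t in Ioi (0 : ℝ), Real.exp (-s * t) * Real.exp (-t * a) := by
  have h := integral_exp_mul_Ioi (a := -(s + a)) (by linarith) 0
  simp only [mul_zero, Real.exp_zero] at h
  rw [show (s + a)⁻¹ = -1 / -(s + a) by field_simp, ← h]
  congr 1; ext t; rw [← Real.exp_add]; congr 1; ring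

lemma kernelForm_resolvent (A : ι → ι → ℝ) (μ : ι → FiniteMeasure K) {s : ℝ} (hs : 0 < s) :
    IntegrableOn (fun t => Real.exp (-s * t) *
      kernelForm A μ (fun p => Real.exp (-t * dist p.1 p.2 ^ 2))) (Ioi 0) ∧
    kernelForm A μ (fun p => (s + dist p.1 p.2 ^ 2)⁻¹) =
      ∫ t in Ioi (0 : ℝ), Real.exp (-s * t) *
        kernelForm A μ (fun p => Real.exp (-t * dist p.1 p.2 ^ 2)) := by
  have hint : ∀ a b, Integrable (fun q : (K × K) × ℝ =>
      Real.exp (-s * q.2) * Real.exp (-q.2 * dist q.1.1 q.1.2 ^ 2))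
      (((μ a : Measure K).prod (μ b : Measure K)).prod (volume.restrict (Ioi 0))) := fun a b => by
    refine integrable_of_abs_le_snd _ _ (Continuous.aestronglyMeasurable (by fun_prop))
      (exp_neg_integrableOn_Ioi 0 hs) ?_
    filter_upwards [ae_restrict_mem measurableSet_Ioi] with t ht p
    have ht : 0 < t := ht
    rw [abs_of_pos (by positivity)]
    refine mul_le_of_le_one_right (Real.exp_pos _).le (Real.exp_le_one_iff.2 ?_)
    have : 0 ≤ t * dist p.1 p.2 ^ 2 := by positivity
    linarith
  have h1 := integrable_kernelForm A μ (volume.restrict (Ioi 0)) (fun t p =>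
    Real.exp (-s * t) * Real.exp (-t * dist p.1 p.2 ^ 2)) hint
  have h2 := kernelForm_integral A μ (volume.restrict (Ioi 0)) (fun t p =>
    Real.exp (-s * t) * Real.exp (-t * dist p.1 p.2 ^ 2)) hint
  simp only [kernelForm_const_mul] at h1 h2
  refine ⟨h1, ?_⟩
  rw [← h2]
  congr 1; ext p
  exact inv_add_sq_eq_integral hs _ (by positivity)

lemma kernelForm_resolvent_nonneg {A : ι → ι → ℝ}
    (hA : ∀ x : ι → ℝ, 0 ≤ ∑ a, ∑ b, A a b * (x a * x b))
    (μ : ι → FiniteMeasure K) {s : ℝ} (hs : 0 < s) :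
    0 ≤ kernelForm A μ (fun p => (s + dist p.1 p.2 ^ 2)⁻¹) := by
  rw [(kernelForm_resolvent A μ hs).2]
  exact setIntegral_nonneg measurableSet_Ioi fun t ht =>
    mul_nonneg (Real.exp_pos _).le (kernelForm_gaussian_nonneg hA μ ht)

lemma kernelForm_resolvent_pos {A : ι → ι → ℝ}
    (hA : ∀ x : ι → ℝ, 0 ≤ ∑ a, ∑ b, A a b * (x a * x b))
    (μ : ι → FiniteMeasure K) {ξ : E} (hξ : frequencyForm A μ ξ ≠ 0) {s : ℝ} (hs : 0 < s) :
    0 < kernelForm A μ (fun p => (s + dist p.1 p.2 ^ 2)⁻¹) := by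
  obtain ⟨h1, h2⟩ := kernelForm_resolvent A μ hs
  have hpos : ∀ t ∈ Ioi (0 : ℝ), 0 < Real.exp (-s * t) *
      kernelForm A μ (fun p => Real.exp (-t * dist p.1 p.2 ^ 2)) := fun t ht =>
    mul_pos (Real.exp_pos _) (kernelForm_gaussian_pos hA μ hξ ht)
  rw [h2, setIntegral_pos_iff_support_of_nonneg_ae ?_ h1]
  · have : (Ioi (0 : ℝ)) ⊆ Function.support (fun t => Real.exp (-s * t) *
      kernelForm A μ (fun p => Real.exp (-t * dist p.1 p.2 ^ 2))) := fun t ht => (hpos t ht).ne'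
    rw [inter_eq_self_of_subset_right this]
    simp
  · filter_upwards [ae_restrict_mem measurableSet_Ioi] with t ht using (hpos t ht).le

/-- The regularized logarithmic kernel `log (1 / √(ε + |x - y|²))`. -/
noncomputable def regKernel {X : Type*} [PseudoMetricSpace X] (ε : ℝ) (p : X × X) : ℝ :=
  -(1 / 2) * Real.log (ε + dist p.1 p.2 ^ 2)

lemma continuous_regKernel {X : Type*} [PseudoMetricSpace X] {ε : ℝ} (hε : 0 < ε) :
    Continuous (regKernel (X := X) ε) := by
  unfold regKernel
  refine continuous_const.mul (Continuous.log (by fun_prop) fun p => ?_)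
  positivity

lemma regKernel_anti {X : Type*} [PseudoMetricSpace X] {ε δ : ℝ} (hε : 0 < ε) (h : ε ≤ δ)
    (p : X × X) : regKernel δ p ≤ regKernel ε p := by
  unfold regKernel
  have := Real.log_le_log (x := ε + dist p.1 p.2 ^ 2) (by positivity)
    (show _ ≤ δ + dist p.1 p.2 ^ 2 by linarith)
  linarith

/-- The derivative of `regKernel s p` in s is minus half the resolvent kernel. -/
lemma regKernel_sub_eq_integral {X : Type*} [PseudoMetricSpace X] {ε δ : ℝ} (hε : 0 < ε)
    (h : ε ≤ δ) (p : X × X) :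
    regKernel ε p - regKernel δ p = (1 / 2) * ∫ s in Ioc ε δ, (s + dist p.1 p.2 ^ 2)⁻¹ := by
  have h0 : 0 < ε + dist p.1 p.2 ^ 2 := by positivity
  have h1 : 0 < δ + dist p.1 p.2 ^ 2 := by linarith
  rw [← intervalIntegral.integral_of_le h,
    intervalIntegral.integral_comp_add_right (fun s => s⁻¹), integral_inv_of_pos h0 h1,
    Real.log_div h1.ne' h0.ne']
  unfold regKernel
  ring

lemma kernelForm_regKernel_sub (A : ι → ι → ℝ) (μ : ι → FiniteMeasure K) {ε δ : ℝ} (hε : 0 < ε)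
    (h : ε ≤ δ) :
    IntegrableOn (fun s => kernelForm A μ (fun p => (s + dist p.1 p.2 ^ 2)⁻¹)) (Ioc ε δ) ∧
    kernelForm A μ (fun p => regKernel ε p - regKernel δ p) =
      (1 / 2) * ∫ s in Ioc ε δ, kernelForm A μ (fun p => (s + dist p.1 p.2 ^ 2)⁻¹) := by
  have hint : ∀ a b, Integrable (fun q : (K × K) × ℝ => (q.2 + dist q.1.1 q.1.2 ^ 2)⁻¹)
      (((μ a : Measure K).prod (μ b : Measure K)).prod (volume.restrict (Ioc ε δ))) := fun a b => by
    refine integrable_of_abs_le_snd (g := fun _ => ε⁻¹) _ _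
      (Measurable.aestronglyMeasurable (by fun_prop)) (integrable_const _) ?_
    filter_upwards [ae_restrict_mem measurableSet_Ioc] with t ht p
    have ht' : 0 < t := hε.trans ht.1
    rw [abs_of_pos (by positivity)]
    refine inv_anti₀ hε ?_
    have := ht.1
    have : 0 ≤ dist p.1 p.2 ^ 2 := by positivity
    linarith
  have h1 := integrable_kernelForm A μ (volume.restrict (Ioc ε δ)) (fun s p =>
    (s + dist p.1 p.2 ^ 2)⁻¹) hint
  have h2 := kernelForm_integral A μ (volume.restrict (Ioc ε δ)) (fun s p =>
    (s + dist p.1 p.2 ^ 2)⁻¹) hint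
  refine ⟨h1, ?_⟩
  rw [← h2, ← kernelForm_const_mul]
  congr 1; ext p
  exact regKernel_sub_eq_integral hε h p

lemma kernelForm_regKernel_sub_nonneg {A : ι → ι → ℝ}
    (hA : ∀ x : ι → ℝ, 0 ≤ ∑ a, ∑ b, A a b * (x a * x b))
    (μ : ι → FiniteMeasure K) {ε δ : ℝ} (hε : 0 < ε) (h : ε ≤ δ) :
    0 ≤ kernelForm A μ (fun p => regKernel ε p - regKernel δ p) := by
  rw [(kernelForm_regKernel_sub A μ hε h).2]
  refine mul_nonneg (by norm_num) (setIntegral_nonneg measurableSet_Ioc fun s hs =>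
    kernelForm_resolvent_nonneg hA μ (hε.trans hs.1))

lemma kernelForm_regKernel_sub_pos {A : ι → ι → ℝ}
    (hA : ∀ x : ι → ℝ, 0 ≤ ∑ a, ∑ b, A a b * (x a * x b))
    (μ : ι → FiniteMeasure K) {ξ : E} (hξ : frequencyForm A μ ξ ≠ 0) {ε δ : ℝ} (hε : 0 < ε)
    (h : ε < δ) :
    0 < kernelForm A μ (fun p => regKernel ε p - regKernel δ p) := by
  obtain ⟨h1, h2⟩ := kernelForm_regKernel_sub A μ hε h.le
  rw [h2, ← intervalIntegral.integral_of_le h.le]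
  refine mul_pos (by norm_num) (intervalIntegral.intervalIntegral_pos_of_pos_on
    ((intervalIntegrable_iff_integrableOn_Ioc_of_le h.le).2 h1)
    (fun s hs => kernelForm_resolvent_pos hA μ hξ (hε.trans hs.1)) h)

end PositiveDefinite

/-! ### Monotone convergence for extended-real integrals -/

section ExtIntegral

open Filter Topology

variable {X : Type*} [MeasurableSpace X]

lemma coe_integral_eq_sub {P : Measure X} {f : X → ℝ} (hf : Integrable f P) :
    ((∫ x, f x ∂P : ℝ) : EReal) =
      ((∫⁻ x, ENNReal.ofReal (f x) ∂P : ℝ≥0∞) : EReal) +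
        -((∫⁻ x, ENNReal.ofReal (-f x) ∂P : ℝ≥0∞) : EReal) := by
  have hneg : ∫⁻ x, ENNReal.ofReal (-f x) ∂P ≠ ∞ := hf.neg.lintegral_lt_top.ne
  rw [integral_eq_lintegral_pos_part_sub_lintegral_neg_part hf, EReal.coe_sub,
    EReal.coe_ennreal_toReal hf.lintegral_lt_top.ne,
    EReal.coe_ennreal_toReal hneg, sub_eq_add_neg]

/-- Monotone convergence towards the integral of an extended-real function. -/
lemma tendsto_extIntegral {P : Measure X} {f : ℕ → X → ℝ} {F : X → EReal}
    (hf : ∀ n, Integrable (f n) P) (hmono : Monotone f)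
    (hlim : ∀ x, Tendsto (fun n => (f n x : EReal)) atTop (𝓝 (F x))) :
    Tendsto (fun n => ((∫ x, f n x ∂P : ℝ) : EReal)) atTop (𝓝 (extIntegral P F)) := by
  have hpos : Tendsto (fun n => ∫⁻ x, ENNReal.ofReal (f n x) ∂P) atTop
      (𝓝 (∫⁻ x, (F x).toENNReal ∂P)) := by
    refine lintegral_tendsto_of_tendsto_of_monotone
      (fun n => (hf n).aestronglyMeasurable.aemeasurable.ennreal_ofReal)
      (ae_of_all _ fun x i j hij => ENNReal.ofReal_le_ofReal (hmono hij x))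
      (ae_of_all _ fun x => ?_)
    exact (EReal.continuous_toENNReal.tendsto _).comp (hlim x)
  -- The negative parts decrease, and the one of `f 0` has finite integral; this permits antitone
  -- convergence and rules out ∞ - ∞ in the limit.
  have hfin : ∫⁻ x, ENNReal.ofReal (-f 0 x) ∂P ≠ ∞ :=
    (hf 0).neg.lintegral_lt_top.ne
  have hneg : Tendsto (fun n => ∫⁻ x, ENNReal.ofReal (-f n x) ∂P) atTop
      (𝓝 (∫⁻ x, (-F x).toENNReal ∂P)) := by
    refine lintegral_tendsto_of_tendsto_of_antitone
      (fun n => (hf n).aestronglyMeasurable.aemeasurable.neg.ennreal_ofReal)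
      (ae_of_all _ fun x i j hij => ENNReal.ofReal_le_ofReal (neg_le_neg (hmono hij x))) hfin
      (ae_of_all _ fun x => ?_)
    exact ((EReal.continuous_toENNReal.comp continuous_neg).tendsto _).comp (hlim x)
  have hnegfin : ∫⁻ x, (-F x).toENNReal ∂P ≠ ∞ := by
    refine ne_top_of_le_ne_top hfin (lintegral_mono fun x => ?_)
    rw [← EReal.real_coe_toENNReal, EReal.coe_neg]
    refine EReal.toENNReal_le_toENNReal (EReal.neg_le_neg_iff.2 ?_)
    refine Monotone.ge_of_tendsto (fun i j hij => ?_) (hlim x) 0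
    exact EReal.coe_le_coe_iff.2 (hmono hij x)
  simp only [coe_integral_eq_sub (hf _)]
  unfold extIntegral
  rw [sub_eq_add_neg]
  have hc := EReal.continuousAt_add
    (p := (((∫⁻ x, (F x).toENNReal ∂P : ℝ≥0∞) : EReal), -((∫⁻ x, (-F x).toENNReal ∂P : ℝ≥0∞) : EReal)))
    (Or.inr (by simpa using hnegfin)) (Or.inl (EReal.coe_ennreal_ne_bot _))
  exact hc.tendsto.comp
    (((continuous_coe_ennreal_ereal.tendsto _).comp hpos).prodMk_nhds
      ((continuous_neg.tendsto _).comp ((continuous_coe_ennreal_ereal.tendsto _).comp hneg)))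

end ExtIntegral

/-! ### Approximation from below by continuous functions -/

section Approximation

open Filter Topology

variable {X : Type*}

lemma coe_regKernel [PseudoMetricSpace X] {ε : ℝ} (hε : 0 < ε) (p : X × X) :
    ((regKernel ε p : ℝ) : EReal) =
      ENNReal.log (ENNReal.ofReal (√(ε + dist p.1 p.2 ^ 2)))⁻¹ := by
  have h : 0 < ε + dist p.1 p.2 ^ 2 := by positivity
  rw [ENNReal.log_inv, ENNReal.log_ofReal_of_pos (Real.sqrt_pos.2 h), Real.log_sqrt h.le,
    ← EReal.coe_neg]
  unfold regKernel
  congr 1; ring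

lemma tendsto_regKernel [PseudoMetricSpace X] (p : X × X) :
    Tendsto (fun N : ℕ => ((regKernel (1 / ((N : ℝ) + 1)) p : ℝ) : EReal)) atTop
      (𝓝 (logKernel p.1 p.2)) := by
  have h1 : Tendsto (fun N : ℕ => ENNReal.ofReal (√(1 / ((N : ℝ) + 1) + dist p.1 p.2 ^ 2))) atTop
      (𝓝 (edist p.1 p.2)) := by
    rw [edist_dist]
    refine (ENNReal.continuous_ofReal.tendsto _).comp ?_
    have := (Real.continuous_sqrt.tendsto _).comp
      ((tendsto_one_div_add_atTop_nhds_zero_nat (𝕜 := ℝ)).add_const (dist p.1 p.2 ^ 2))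
    rwa [zero_add, Real.sqrt_sq dist_nonneg] at this
  simp only [coe_regKernel (show (0 : ℝ) < 1 / (((_ : ℕ) : ℝ) + 1) by positivity)]
  exact (ENNReal.continuous_log.tendsto _).comp
    ((continuous_inv.tendsto _).comp h1)

/-- A lower semicontinuous function on a compact metric space which does not take the value `-∞`
is the limit of an increasing sequence of real continuous functions. -/
lemma LowerSemicontinuous.exists_monotone_tendsto [MetricSpace X] [CompactSpace X] {F : X → EReal}
    (hF : LowerSemicontinuous F) (hbot : ∀ x, F x ≠ ⊥) :
    ∃ f : ℕ → X → ℝ, (∀ n, Continuous (f n)) ∧ Monotone f ∧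
      ∀ x, Tendsto (fun n => (f n x : EReal)) atTop (𝓝 (F x)) := by
  rcases isEmpty_or_nonempty X with hX | hX
  · exact ⟨fun _ _ => 0, fun _ => continuous_const, monotone_const, fun x => isEmptyElim x⟩
  obtain ⟨x₀, -, hx₀⟩ := LowerSemicontinuousOn.exists_isMinOn (f := F) univ_nonempty isCompact_univ
    (lowerSemicontinuousOn_univ_iff.2 hF)
  obtain ⟨r, -, hr⟩ := EReal.lt_iff_exists_real_btwn.1 (bot_lt_iff_ne_bot.2 (hbot x₀))
  have hrF : ∀ y, (r : EReal) ≤ F y := fun y => hr.le.trans (hx₀ (mem_univ y))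
  -- Truncating at `r + N`, with `r` a lower bound of `F`, makes the values real.
  let W : ℕ → X → ℝ := fun N y => (min (F y) ((r + N : ℝ) : EReal)).toReal
  have hWcoe : ∀ N y, ((W N y : ℝ) : EReal) = min (F y) ((r + N : ℝ) : EReal) := fun N y => by
    refine EReal.coe_toReal ?_ ?_
    · exact ((min_le_right _ _).trans_lt (EReal.coe_lt_top _)).ne
    · refine ((EReal.bot_lt_coe r).trans_le (le_min (hrF y) ?_)).ne'
      exact EReal.coe_le_coe_iff.2 (by simp)
  have hWr : ∀ N y, r ≤ W N y := fun N y => by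
    rw [← EReal.coe_le_coe_iff, hWcoe]
    exact le_min (hrF y) (EReal.coe_le_coe_iff.2 (by simp))
  have hWF : ∀ N y, ((W N y : ℝ) : EReal) ≤ F y := fun N y => by
    rw [hWcoe]; exact min_le_left _ _
  have hWmono : Monotone W := fun N M h y => by
    rw [← EReal.coe_le_coe_iff, hWcoe, hWcoe]
    refine min_le_min le_rfl (EReal.coe_le_coe_iff.2 ?_)
    have : (N : ℝ) ≤ M := by exact_mod_cast h
    linarith
  have hbdd : ∀ (N : ℕ) x, BddBelow (range fun y => W N y + N * dist x y) := fun N x =>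
    ⟨r, by rintro _ ⟨y, rfl⟩; exact le_add_of_le_of_nonneg (hWr N y) (by positivity)⟩
  -- Inf-convolution with N·dist: an N-Lipschitz minorant of `W N`.
  let f : ℕ → X → ℝ := fun N x => ⨅ y, (W N y + N * dist x y)
  have hfW : ∀ N x, f N x ≤ W N x := fun N x => by
    have := ciInf_le (hbdd N x) x
    simpa using this
  have hfmono : Monotone f := fun N M h x => by
    refine ciInf_mono (hbdd N x) fun y => add_le_add (hWmono h y) ?_
    gcongr
  refine ⟨f, fun N => ?_, hfmono, fun x => ?_⟩
  · refine (LipschitzWith.of_le_add_mul (N : ℝ≥0) fun x x' => ?_).continuous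
    rw [← sub_le_iff_le_add]
    refine le_ciInf fun y => ?_
    rw [sub_le_iff_le_add]
    refine (ciInf_le (hbdd N x) y).trans ?_
    have h := dist_triangle x x' y
    have hN : (0 : ℝ) ≤ N := by positivity
    have := mul_le_mul_of_nonneg_left h hN
    simp only [NNReal.coe_natCast]
    linarith
  · refine tendsto_order.2 ⟨fun a ha => ?_, fun a ha => Eventually.of_forall fun N =>
      (EReal.coe_le_coe_iff.2 (hfW N x)).trans_lt ((hWF N x).trans_lt ha)⟩
    obtain ⟨c, hac, hc⟩ := EReal.lt_iff_exists_real_btwn.1 ha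
    obtain ⟨δ, hδ, hball⟩ := Metric.mem_nhds_iff.1 (hF x c hc)
    obtain ⟨N₁, hN₁⟩ := exists_nat_ge (c - r)
    obtain ⟨N₂, hN₂⟩ := exists_nat_ge ((c - r) / δ)
    filter_upwards [eventually_ge_atTop (max N₁ N₂)] with N hN
    have hN1 : (N₁ : ℝ) ≤ N := by exact_mod_cast (le_max_left _ _).trans hN
    have hN2 : (N₂ : ℝ) ≤ N := by exact_mod_cast (le_max_right _ _).trans hN
    refine hac.trans_le (EReal.coe_le_coe_iff.2 (le_ciInf fun y => ?_))
    -- Near x, semicontinuity gives F > c; far from x, the penalty N·δ already exceeds c - r or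
    -- equals it.
    rcases lt_or_ge (dist y x) δ with hy | hy
    · have hcy : (c : EReal) < F y := hball hy
      refine le_add_of_le_of_nonneg ?_ (by positivity)
      rw [← EReal.coe_le_coe_iff, hWcoe]
      exact le_min hcy.le (EReal.coe_le_coe_iff.2 (by linarith))
    · rw [dist_comm] at hy
      have h1 : c - r ≤ N * δ := by
        rw [← div_le_iff₀ hδ]; linarith
      have h2 : (N : ℝ) * δ ≤ N * dist x y := by gcongr
      have := hWr N y
      linarith

end Approximation

/-! ### Coercivity of positive definite forms -/

section QuadraticForm

open Filter Topology

lemma Matrix.PosDef.sum_sum_pos {d : ℕ} {C : Matrix (Fin d) (Fin d) ℝ} (hC : C.PosDef)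
    {x : Fin d → ℝ} (hx : x ≠ 0) : 0 < ∑ i, ∑ j, C i j * (x i * x j) := by
  have h := hC.dotProduct_mulVec_pos hx
  simp only [dotProduct, Matrix.mulVec, Finset.mul_sum] at h
  refine h.trans_eq (Finset.sum_congr rfl fun i _ => Finset.sum_congr rfl fun j _ => ?_)
  simp only [Pi.star_apply, star_trivial]
  ring

lemma Matrix.PosDef.sum_sum_nonneg {d : ℕ} {C : Matrix (Fin d) (Fin d) ℝ} (hC : C.PosDef)
    (x : Fin d → ℝ) : 0 ≤ ∑ i, ∑ j, C i j * (x i * x j) := by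
  rcases eq_or_ne x 0 with rfl | hx
  · simp
  · exact (hC.sum_sum_pos hx).le

/-- A positive definite form dominates a positive multiple of the square norm. -/
lemma Matrix.PosDef.exists_pos_mul_le {d : ℕ} {C : Matrix (Fin d) (Fin d) ℝ} (hC : C.PosDef) :
    ∃ c > 0, ∀ x : Fin d → ℝ, c * ∑ i, x i ^ 2 ≤ ∑ i, ∑ j, C i j * (x i * x j) := by
  let q : EuclideanSpace ℝ (Fin d) → ℝ := fun x => ∑ i, ∑ j, C i j * (x i * x j)
  have hq : Continuous q := by fun_prop
  -- The sphere is empty exactly when d = 0; otherwise c is the minimum of the form on it.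
  rcases (Metric.sphere (0 : EuclideanSpace ℝ (Fin d)) 1).eq_empty_or_nonempty with he | hne
  · refine ⟨1, one_pos, fun x => ?_⟩
    have hx : x = 0 := by
      by_contra hx
      have h0 : WithLp.toLp 2 x ≠ 0 := fun h => hx (by simpa using h)
      have : (‖WithLp.toLp 2 x‖⁻¹ • WithLp.toLp 2 x : EuclideanSpace ℝ (Fin d)) ∈
          Metric.sphere (0 : EuclideanSpace ℝ (Fin d)) 1 := by
        simp [norm_smul, inv_mul_cancel₀ (norm_ne_zero_iff.2 h0)]
      rw [he] at this
      exact this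
    simp [hx]
  · obtain ⟨x₀, hx₀, hmin⟩ := (isCompact_sphere (0 : EuclideanSpace ℝ (Fin d)) 1).exists_isMinOn
      hne hq.continuousOn
    have hx₀' : x₀.ofLp ≠ 0 := fun h => by
      have : x₀ = 0 := by ext i; simpa using congrFun h i
      simp [this] at hx₀
    refine ⟨q x₀, hC.sum_sum_pos hx₀', fun x => ?_⟩
    rcases eq_or_ne x 0 with rfl | hx
    · simp
    set y : EuclideanSpace ℝ (Fin d) := WithLp.toLp 2 x with hy
    have h0 : 0 < ‖y‖ := norm_pos_iff.2 fun h => hx (by simpa [hy] using h)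
    have hmem : ‖y‖⁻¹ • y ∈ Metric.sphere (0 : EuclideanSpace ℝ (Fin d)) 1 := by
      simp [norm_smul, inv_mul_cancel₀ h0.ne']
    have h1 : q x₀ ≤ q (‖y‖⁻¹ • y) := hmin hmem
    have h2 : q (‖y‖⁻¹ • y) = (‖y‖ ^ 2)⁻¹ * q y := by
      simp only [q, Finset.mul_sum, PiLp.smul_apply, smul_eq_mul]
      exact Finset.sum_congr rfl fun i _ => Finset.sum_congr rfl fun j _ => by ring
    have h3 : ‖y‖ ^ 2 = ∑ i, x i ^ 2 := by
      rw [EuclideanSpace.real_norm_sq_eq]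
    rw [h2, inv_mul_eq_div, le_div_iff₀ (by positivity), h3] at h1
    exact h1

end QuadraticForm

/-! ### Regularized energies and their limits -/

section Energy

open Filter Topology

variable {E : Type*} [NormedAddCommGroup E] [InnerProductSpace ℝ E] [MeasurableSpace E]
  [BorelSpace E] [FiniteDimensional ℝ E] {K : Set E} [CompactSpace K]

/-- The mutual energy for the regularized kernel. -/
noncomputable def regEnergy (N : ℕ) (μ ν : FiniteMeasure K) : ℝ :=
  ∫ p, regKernel (1 / ((N : ℝ) + 1)) p ∂((μ : Measure K).prod (ν : Measure K))

lemma integrable_of_continuous {Y : Type*} [TopologicalSpace Y] [CompactSpace Y]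
    [MeasurableSpace Y] [OpensMeasurableSpace Y] {f : Y → ℝ} (hf : Continuous f) (P : Measure Y)
    [IsFiniteMeasure P] : Integrable f P :=
  hf.integrable_of_hasCompactSupport (HasCompactSupport.of_compactSpace f)

lemma continuous_regKernel_nat {X : Type*} [PseudoMetricSpace X] (N : ℕ) :
    Continuous (regKernel (X := X) (1 / ((N : ℝ) + 1))) :=
  continuous_regKernel (by positivity)

lemma integrable_regKernel (N : ℕ) (μ ν : FiniteMeasure K) :
    Integrable (regKernel (1 / ((N : ℝ) + 1)))
      ((μ : Measure K).prod (ν : Measure K)) :=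
  integrable_of_continuous (continuous_regKernel_nat N) _

lemma one_div_add_one_anti {N M : ℕ} (h : N ≤ M) : 1 / ((M : ℝ) + 1) ≤ 1 / ((N : ℝ) + 1) := by
  have : (N : ℝ) ≤ M := by exact_mod_cast h
  gcongr

lemma monotone_regKernel {X : Type*} [PseudoMetricSpace X] :
    Monotone fun N : ℕ => regKernel (X := X) (1 / ((N : ℝ) + 1)) :=
  fun _ _ h p => regKernel_anti (by positivity) (one_div_add_one_anti h) p

lemma regEnergy_mono (μ ν : FiniteMeasure K) : Monotone fun N => regEnergy N μ ν :=
  fun N M h => integral_mono (integrable_regKernel N μ ν) (integrable_regKernel M μ ν)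
    (monotone_regKernel h)

lemma regEnergy_comm (N : ℕ) (μ ν : FiniteMeasure K) : regEnergy N μ ν = regEnergy N ν μ := by
  unfold regEnergy
  rw [← Measure.prod_swap, integral_map measurable_swap.aemeasurable
    (continuous_regKernel_nat N).aestronglyMeasurable]
  simp [regKernel, dist_comm]

lemma tendsto_regEnergy (μ ν : FiniteMeasure K) :
    Tendsto (fun N => (regEnergy N μ ν : EReal)) atTop (𝓝 (mutualEnergy μ ν)) :=
  tendsto_extIntegral (fun N => integrable_regKernel N μ ν) monotone_regKernel tendsto_regKernel

lemma regEnergy_le_mutualEnergy (N : ℕ) (μ ν : FiniteMeasure K) :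
    (regEnergy N μ ν : EReal) ≤ mutualEnergy μ ν :=
  Monotone.ge_of_tendsto (fun _ _ h => EReal.coe_le_coe_iff.2 (regEnergy_mono μ ν h))
    (tendsto_regEnergy μ ν) N

lemma mutualEnergy_ne_bot (μ ν : FiniteMeasure K) : mutualEnergy μ ν ≠ ⊥ :=
  ((EReal.bot_lt_coe _).trans_le (regEnergy_le_mutualEnergy 0 μ ν)).ne'

/-- The quadratic form of `A` for the regularized kernel increases with the regularization index
when `A` is positive semidefinite. -/
lemma sum_regEnergy_sub_nonneg {ι : Type*} [Fintype ι] {A : ι → ι → ℝ}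
    (hA : ∀ x : ι → ℝ, 0 ≤ ∑ a, ∑ b, A a b * (x a * x b)) (μ : ι → FiniteMeasure K) {N M : ℕ}
    (h : N ≤ M) :
    ∑ a, ∑ b, A a b * regEnergy N (μ a) (μ b) ≤ ∑ a, ∑ b, A a b * regEnergy M (μ a) (μ b) := by
  have h1 := kernelForm_regKernel_sub_nonneg hA μ (ε := 1 / ((M : ℝ) + 1))
    (by positivity) (one_div_add_one_anti h)
  rw [kernelForm_sub A μ (fun a b => integrable_regKernel M (μ a) (μ b))
    (fun a b => integrable_regKernel N (μ a) (μ b))] at h1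
  exact sub_nonneg.1 h1

/-- The regularized energy of μ - ν, with matrix entries ±1, is at least its value at index 0. This
bounds the cross term by the two finite self-energies. -/
lemma mutualEnergy_lt_top {μ ν : FiniteMeasure K} (hμ : logEnergy μ < ⊤) (hν : logEnergy ν < ⊤) :
    mutualEnergy μ ν < ⊤ := by
  let A : Bool → Bool → ℝ := fun a b => if a = b then 1 else -1
  have hA : ∀ x : Bool → ℝ, 0 ≤ ∑ a, ∑ b, A a b * (x a * x b) := fun x => by
    simp only [Fintype.sum_bool, A]
    simp
    nlinarith [sq_nonneg (x true - x false)]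
  set a := (logEnergy μ).toReal
  set b := (logEnergy ν).toReal
  have ha : ∀ N, regEnergy N μ μ ≤ a := fun N => by
    rw [← EReal.coe_le_coe_iff, EReal.coe_toReal hμ.ne (mutualEnergy_ne_bot μ μ)]
    exact regEnergy_le_mutualEnergy N μ μ
  have hb : ∀ N, regEnergy N ν ν ≤ b := fun N => by
    rw [← EReal.coe_le_coe_iff, EReal.coe_toReal hν.ne (mutualEnergy_ne_bot ν ν)]
    exact regEnergy_le_mutualEnergy N ν ν
  have key : ∀ N, regEnergy N μ ν ≤
      (a + b - regEnergy 0 μ μ - regEnergy 0 ν ν + 2 * regEnergy 0 μ ν) / 2 := fun N => by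
    have h := sum_regEnergy_sub_nonneg hA (fun i => if i then μ else ν) (Nat.zero_le N)
    simp only [Fintype.sum_bool, A] at h
    simp only [if_true, Bool.false_eq_true, if_false, reduceCtorEq] at h
    rw [regEnergy_comm N ν μ, regEnergy_comm 0 ν μ] at h
    linarith [ha N, hb N]
  exact (le_of_tendsto' (tendsto_regEnergy μ ν) fun N => EReal.coe_le_coe_iff.2 (key N)).trans_lt
    (EReal.coe_lt_top _)

lemma EReal.coe_sum_real {ι : Type*} (s : Finset ι) (f : ι → ℝ) :
    ((∑ i ∈ s, f i : ℝ) : EReal) = ∑ i ∈ s, (f i : EReal) := by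
  classical
  induction s using Finset.induction_on with
  | empty => simp
  | insert a s ha ih => rw [Finset.sum_insert ha, Finset.sum_insert ha, EReal.coe_add, ih]

/-- The functional `J₀` is the limit of its regularizations. -/
lemma tendsto_energyJ0 {d : ℕ} {C : Matrix (Fin d) (Fin d) ℝ} (hC : C.PosDef)
    (μ : Fin d → FiniteMeasure K) :
    Tendsto (fun N => ((∑ i, ∑ j, C i j * regEnergy N (μ i) (μ j) : ℝ) : EReal)) atTop
      (𝓝 (energyJ0 C μ)) := by
  unfold energyJ0
  split_ifs with hfin
  · have hI : ∀ i j, (((mutualEnergy (μ i) (μ j)).toReal : ℝ) : EReal) = mutualEnergy (μ i) (μ j) :=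
      fun i j => EReal.coe_toReal (mutualEnergy_lt_top (hfin i) (hfin j)).ne
        (mutualEnergy_ne_bot _ _)
    have hlim : ∀ i j, Tendsto (fun N => regEnergy N (μ i) (μ j)) atTop
        (𝓝 (mutualEnergy (μ i) (μ j)).toReal) := fun i j => by
      rw [← EReal.tendsto_coe, hI]
      exact tendsto_regEnergy _ _
    have hsum : ∑ i, ∑ j, ((C i j : ℝ) : EReal) * mutualEnergy (μ i) (μ j) =
        ((∑ i, ∑ j, C i j * (mutualEnergy (μ i) (μ j)).toReal : ℝ) : EReal) := by
      simp only [EReal.coe_sum_real, EReal.coe_mul, hI]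
    rw [hsum]
    refine EReal.tendsto_coe.2 (tendsto_finsetSum _ fun i _ => tendsto_finsetSum _ fun j _ => ?_)
    exact (hlim i j).const_mul _
  · push Not at hfin
    obtain ⟨i₀, hi₀⟩ := hfin
    obtain ⟨c, hc, hcC⟩ := hC.exists_pos_mul_le
    -- Removing c from the diagonal leaves a positive semidefinite form, which is still monotone in
    -- N; the removed diagonal energies are monotone too, and the one at `i₀` diverges.
    let A : Fin d → Fin d → ℝ := fun i j => C i j - if i = j then c else 0
    have hA : ∀ x : Fin d → ℝ, 0 ≤ ∑ i, ∑ j, A i j * (x i * x j) := fun x => by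
      have := hcC x
      simp only [A, sub_mul, Finset.sum_sub_distrib, ite_mul, zero_mul, Finset.sum_ite_eq,
        Finset.mem_univ, if_true]
      rw [Finset.mul_sum] at this
      simpa [pow_two] using this
    have hlow : ∀ N, c * regEnergy N (μ i₀) (μ i₀) +
        (∑ i, ∑ j, C i j * regEnergy 0 (μ i) (μ j) - c * regEnergy 0 (μ i₀) (μ i₀)) ≤
        ∑ i, ∑ j, C i j * regEnergy N (μ i) (μ j) := fun N => by
      have h := sum_regEnergy_sub_nonneg hA μ (Nat.zero_le N)
      simp only [A, sub_mul, Finset.sum_sub_distrib, ite_mul, zero_mul, Finset.sum_ite_eq,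
        Finset.mem_univ, if_true] at h
      have h2 : c * regEnergy N (μ i₀) (μ i₀) - c * regEnergy 0 (μ i₀) (μ i₀) ≤
          ∑ i, (c * regEnergy N (μ i) (μ i) - c * regEnergy 0 (μ i) (μ i)) :=
        Finset.single_le_sum (f := fun i => c * regEnergy N (μ i) (μ i) -
          c * regEnergy 0 (μ i) (μ i)) (fun i _ => sub_nonneg.2
          (mul_le_mul_of_nonneg_left (regEnergy_mono (μ i) (μ i) (Nat.zero_le N)) hc.le))
          (Finset.mem_univ i₀)
      rw [Finset.sum_sub_distrib] at h2
      linarith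
    have htop : Tendsto (fun N => regEnergy N (μ i₀) (μ i₀)) atTop atTop := by
      rw [← EReal.tendsto_coe_nhds_top_iff, ← top_le_iff.1 hi₀]
      exact tendsto_regEnergy _ _
    rw [EReal.tendsto_coe_nhds_top_iff]
    exact tendsto_atTop_mono hlow (tendsto_atTop_add_const_right _ _ (htop.const_mul_atTop hc))

end Energy

/-! ### Finite sums in `EReal`, away from ⊤ + ⊥ -/

section ERealSums

open Filter Topology

lemma EReal.tendsto_sum_of_ne_bot {ι : Type*} (s : Finset ι) {f : ι → ℕ → EReal} {a : ι → EReal}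
    (ha : ∀ i, a i ≠ ⊥) (hf : ∀ i, Tendsto (f i) atTop (𝓝 (a i))) :
    Tendsto (fun n => ∑ i ∈ s, f i n) atTop (𝓝 (∑ i ∈ s, a i)) ∧ ∑ i ∈ s, a i ≠ ⊥ := by
  classical
  induction s using Finset.induction_on with
  | empty => simp
  | insert i s his ih =>
    simp only [Finset.sum_insert his]
    refine ⟨?_, by simp [EReal.add_eq_bot_iff, ha i, ih.2]⟩
    exact (EReal.continuousAt_add (p := (a i, ∑ i ∈ s, a i)) (Or.inr ih.2)
      (Or.inl (ha i))).tendsto.comp ((hf i).prodMk_nhds ih.1)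

lemma EReal.sum_lt_top {ι : Type*} (s : Finset ι) {a : ι → EReal} (ha : ∀ i, a i < ⊤) :
    ∑ i ∈ s, a i < ⊤ := by
  classical
  induction s using Finset.induction_on with
  | empty => simp
  | insert i s his ih =>
    rw [Finset.sum_insert his]
    exact EReal.add_lt_top (ha i).ne ih.ne

end ERealSums

/-! ### Bilinearity and continuity of the regularized energy -/

section Bilinear

open Filter Topology

variable {E : Type*} [NormedAddCommGroup E] [InnerProductSpace ℝ E] [MeasurableSpace E]
  [BorelSpace E] [FiniteDimensional ℝ E] {K : Set E} [CompactSpace K]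

lemma regEnergy_add_left (N : ℕ) (μ μ' ν : FiniteMeasure K) :
    regEnergy N (μ + μ') ν = regEnergy N μ ν + regEnergy N μ' ν := by
  unfold regEnergy
  rw [FiniteMeasure.toMeasure_add, Measure.add_prod,
    integral_add_measure (integrable_regKernel N μ ν) (integrable_regKernel N μ' ν)]

lemma regEnergy_smul_left (N : ℕ) (c : ℝ≥0) (μ ν : FiniteMeasure K) :
    regEnergy N (c • μ) ν = c * regEnergy N μ ν := by
  unfold regEnergy
  have h : ((c • μ : FiniteMeasure K) : Measure K).prod (ν : Measure K) =
      (c : ℝ≥0∞) • ((μ : Measure K).prod (ν : Measure K)) := by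
    rw [← Measure.prod_smul_left]; rfl
  rw [h, integral_smul_measure]
  simp

lemma regEnergy_comb (N : ℕ) (a b : ℝ≥0) (μ μ' ν ν' : FiniteMeasure K) :
    regEnergy N (a • μ + b • ν) (a • μ' + b • ν') =
      a * a * regEnergy N μ μ' + a * b * regEnergy N μ ν' + b * a * regEnergy N ν μ' +
        b * b * regEnergy N ν ν' := by
  have h : ∀ ρ, regEnergy N ρ (a • μ' + b • ν') = a * regEnergy N ρ μ' + b * regEnergy N ρ ν' :=
    fun ρ => by
      rw [regEnergy_comm, regEnergy_add_left, regEnergy_smul_left, regEnergy_smul_left,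
        regEnergy_comm N μ', regEnergy_comm N ν']
  rw [regEnergy_add_left, regEnergy_smul_left, regEnergy_smul_left, h, h]
  ring

/-- Factoring out the masses reduces to continuity of the product of probability measures;
normalization is continuous at nonzero measures, hence the hypotheses. -/
lemma continuousAt_regEnergy [Nonempty K] (N : ℕ) {p : FiniteMeasure K × FiniteMeasure K}
    (h1 : p.1 ≠ 0) (h2 : p.2 ≠ 0) :
    ContinuousAt (fun p : FiniteMeasure K × FiniteMeasure K => regEnergy N p.1 p.2) p := by
  have heq : ∀ p : FiniteMeasure K × FiniteMeasure K, regEnergy N p.1 p.2 =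
      p.1.mass * (p.2.mass * ∫ q, (⟨_, continuous_regKernel_nat N⟩ : C(K × K, ℝ)) q
        ∂((p.1.normalize.prod p.2.normalize : ProbabilityMeasure (K × K)) : Measure (K × K))) :=
    fun p => by
      conv_lhs => rw [p.1.self_eq_mass_smul_normalize, p.2.self_eq_mass_smul_normalize]
      rw [regEnergy_smul_left, regEnergy_comm, regEnergy_smul_left, regEnergy_comm]
      rfl
  have hn1 : ContinuousAt (fun p : FiniteMeasure K × FiniteMeasure K => p.1.normalize) p :=
    FiniteMeasure.tendsto_normalize_of_tendsto (continuous_fst.tendsto p) h1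
  have hn2 : ContinuousAt (fun p : FiniteMeasure K × FiniteMeasure K => p.2.normalize) p :=
    FiniteMeasure.tendsto_normalize_of_tendsto (continuous_snd.tendsto p) h2
  have hc := ((ProbabilityMeasure.continuous_integral_continuousMap
    (⟨_, continuous_regKernel_nat N⟩ : C(K × K, ℝ))).comp
      (ProbabilityMeasure.continuous_prod (α := K) (β := K))).continuousAt.comp (hn1.prodMk hn2)
  have hm1 : Continuous fun p : FiniteMeasure K × FiniteMeasure K => (p.1.mass : ℝ) := by fun_prop
  have hm2 : Continuous fun p : FiniteMeasure K × FiniteMeasure K => (p.2.mass : ℝ) := by fun_prop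
  rw [show (fun p : FiniteMeasure K × FiniteMeasure K => regEnergy N p.1 p.2) = _ from funext heq]
  exact hm1.continuousAt.mul (hm2.continuousAt.mul hc)

end Bilinear

/-! ### Uniform positive lower bound for the energy of a difference -/

section Gap

open Filter Topology

variable {E : Type*} [NormedAddCommGroup E] [InnerProductSpace ℝ E] [MeasurableSpace E]
  [BorelSpace E] [FiniteDimensional ℝ E] {K : Set E} {d : ℕ}

/-- The sign `±1` of a Boolean. -/
def boolSign (a : Bool) : ℝ := if a then 1 else -1

/-- The matrix of the quadratic form of `C` at differences, on pairs of vectors. -/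
def differenceMatrix (C : Matrix (Fin d) (Fin d) ℝ) (a b : Fin d × Bool) : ℝ :=
  C a.1 b.1 * (boolSign a.2 * boolSign b.2)

/-- A pair of vectors of measures as a single family. -/
def pairFamily (μ ν : Fin d → FiniteMeasure K) (a : Fin d × Bool) : FiniteMeasure K :=
  if a.2 then μ a.1 else ν a.1

lemma sum_differenceMatrix (C : Matrix (Fin d) (Fin d) ℝ) (f : Fin d × Bool → Fin d × Bool → ℝ) :
    ∑ a, ∑ b, differenceMatrix C a b * f a b =
      ∑ i, ∑ j, C i j * (f (i, true) (j, true) - f (i, true) (j, false) - f (i, false) (j, true) +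
        f (i, false) (j, false)) := by
  simp only [Fintype.sum_prod_type, Fintype.sum_bool, differenceMatrix, boolSign,
    ← Finset.sum_add_distrib]
  refine Finset.sum_congr rfl fun i _ => Finset.sum_congr rfl fun j _ => ?_
  simp only [if_true, Bool.false_eq_true, if_false]
  ring

lemma sum_differenceMatrix_mul (C : Matrix (Fin d) (Fin d) ℝ) (x : Fin d × Bool → ℝ) :
    ∑ a, ∑ b, differenceMatrix C a b * (x a * x b) =
      ∑ i, ∑ j, C i j * ((x (i, true) - x (i, false)) * (x (j, true) - x (j, false))) := by
  rw [sum_differenceMatrix C fun a b => x a * x b]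
  exact Finset.sum_congr rfl fun i _ => Finset.sum_congr rfl fun j _ => by ring

lemma differenceMatrix_nonneg {C : Matrix (Fin d) (Fin d) ℝ} (hC : C.PosDef)
    (x : Fin d × Bool → ℝ) : 0 ≤ ∑ a, ∑ b, differenceMatrix C a b * (x a * x b) := by
  rw [sum_differenceMatrix_mul]
  exact hC.sum_sum_nonneg fun i => x (i, true) - x (i, false)

/-- The two transforms are the real and imaginary parts of the characteristic function of the
push-forward to `E`; measurability of `K` makes this push-forward injective. -/
lemma FiniteMeasure.ext_of_cos_sin {μ ν : FiniteMeasure K}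
    (hcos : ∀ ξ : E, ∫ x, Real.cos (inner ℝ ξ (x : E)) ∂(μ : Measure K) =
      ∫ x, Real.cos (inner ℝ ξ (x : E)) ∂(ν : Measure K))
    (hsin : ∀ ξ : E, ∫ x, Real.sin (inner ℝ ξ (x : E)) ∂(μ : Measure K) =
      ∫ x, Real.sin (inner ℝ ξ (x : E)) ∂(ν : Measure K))
    (hK : MeasurableSet K) : μ = ν := by
  have hchar : ∀ (ρ : FiniteMeasure K) (ξ : E),
      charFun ((ρ : Measure K).map (Subtype.val : K → E)) ξ =
        ((∫ x, Real.cos (inner ℝ ξ (x : E)) ∂(ρ : Measure K) : ℝ) : ℂ) +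
        ((∫ x, Real.sin (inner ℝ ξ (x : E)) ∂(ρ : Measure K) : ℝ) : ℂ) * Complex.I := fun ρ ξ => by
    rw [charFun_apply, integral_map measurable_subtype_coe.aemeasurable
      (Continuous.aestronglyMeasurable (by fun_prop)), ← integral_complex_ofReal,
      ← integral_complex_ofReal, ← integral_mul_const, ← integral_add]
    · congr 1; ext x
      rw [Complex.exp_mul_I, real_inner_comm]
      push_cast; rfl
    · exact (integrable_cos_inner ρ ξ).ofReal
    · exact (integrable_sin_inner ρ ξ).ofReal.mul_const _
  have h : (μ : Measure K).map (Subtype.val : K → E) = (ν : Measure K).map Subtype.val := by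
    refine Measure.ext_of_charFun (funext fun ξ => ?_)
    rw [hchar, hchar, hcos, hsin]
  refine FiniteMeasure.toMeasure_injective ?_
  have he := MeasurableEmbedding.subtype_coe hK
  rw [← he.comap_map (μ : Measure K), h, he.comap_map]

lemma exists_frequencyForm_ne_zero {C : Matrix (Fin d) (Fin d) ℝ} (hC : C.PosDef)
    {μ ν : Fin d → FiniteMeasure K} (hne : μ ≠ ν) (hK : MeasurableSet K) :
    ∃ ξ : E, frequencyForm (differenceMatrix C) (pairFamily μ ν) ξ ≠ 0 := by
  by_contra! h
  refine hne (funext fun i => ?_)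
  have key : ∀ ξ : E,
      (fun i => (∫ x, Real.cos (inner ℝ ξ (x : E)) ∂(μ i : Measure K)) -
        ∫ x, Real.cos (inner ℝ ξ (x : E)) ∂(ν i : Measure K)) = 0 ∧
      (fun i => (∫ x, Real.sin (inner ℝ ξ (x : E)) ∂(μ i : Measure K)) -
        ∫ x, Real.sin (inner ℝ ξ (x : E)) ∂(ν i : Measure K)) = 0 := fun ξ => by
    have h1 := h ξ
    simp only [frequencyForm, mul_add, Finset.sum_add_distrib] at h1
    rw [sum_differenceMatrix_mul C fun a =>
        ∫ x, Real.cos (inner ℝ ξ (x : E)) ∂(pairFamily μ ν a : Measure K),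
      sum_differenceMatrix_mul C fun a =>
        ∫ x, Real.sin (inner ℝ ξ (x : E)) ∂(pairFamily μ ν a : Measure K)] at h1
    simp only [pairFamily, if_true, Bool.false_eq_true, if_false] at h1
    obtain ⟨h2, h3⟩ := (add_eq_zero_iff_of_nonneg (hC.sum_sum_nonneg fun i =>
        (∫ x, Real.cos (inner ℝ ξ (x : E)) ∂(μ i : Measure K)) -
        ∫ x, Real.cos (inner ℝ ξ (x : E)) ∂(ν i : Measure K))
      (hC.sum_sum_nonneg fun i => (∫ x, Real.sin (inner ℝ ξ (x : E)) ∂(μ i : Measure K)) -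
        ∫ x, Real.sin (inner ℝ ξ (x : E)) ∂(ν i : Measure K))).1 h1
    exact ⟨by_contra fun h0 => (hC.sum_sum_pos h0).ne' h2,
      by_contra fun h0 => (hC.sum_sum_pos h0).ne' h3⟩
  exact FiniteMeasure.ext_of_cos_sin (fun ξ => sub_eq_zero.1 (congrFun (key ξ).1 i))
    (fun ξ => sub_eq_zero.1 (congrFun (key ξ).2 i)) hK

/-- A lower bound for the energy of the difference of two vectors of measures. -/
noncomputable def energyGap (C : Matrix (Fin d) (Fin d) ℝ) (μ ν : Fin d → FiniteMeasure K) : ℝ :=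
  kernelForm (differenceMatrix C) (pairFamily μ ν) fun p => regKernel 1 p - regKernel 2 p

lemma energyGap_pos {C : Matrix (Fin d) (Fin d) ℝ} (hC : C.PosDef) {μ ν : Fin d → FiniteMeasure K}
    (hne : μ ≠ ν) (hK : MeasurableSet K) : 0 < energyGap C μ ν := by
  obtain ⟨ξ, hξ⟩ := exists_frequencyForm_ne_zero hC hne hK
  exact kernelForm_regKernel_sub_pos (differenceMatrix_nonneg hC) _ hξ one_pos one_lt_two

variable [CompactSpace K]

/-- With δ = n + 2, the integrand is -½ log(1 + |x - y|²/δ), which tends to 0 and is dominated by |x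
- y|². -/
lemma tendsto_integral_regKernel_add_log (μ ν : FiniteMeasure K) :
    Tendsto (fun n : ℕ => ∫ p, (regKernel ((n : ℝ) + 2) p + 1 / 2 * Real.log ((n : ℝ) + 2))
      ∂((μ : Measure K).prod (ν : Measure K))) atTop (𝓝 0) := by
  have hrw : ∀ (n : ℕ) (p : K × K), regKernel ((n : ℝ) + 2) p + 1 / 2 * Real.log ((n : ℝ) + 2) =
      -(1 / 2) * Real.log (1 + dist p.1 p.2 ^ 2 / ((n : ℝ) + 2)) := fun n p => by
    have h2 : (0 : ℝ) < (n : ℝ) + 2 := by positivity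
    have : (n : ℝ) + 2 + dist p.1 p.2 ^ 2 = (n + 2) * (1 + dist p.1 p.2 ^ 2 / ((n : ℝ) + 2)) := by
      field_simp
    unfold regKernel
    rw [this, Real.log_mul h2.ne' (by positivity)]
    ring
  simp only [hrw]
  rw [show (0 : ℝ) = ∫ p, (0 : ℝ) ∂((μ : Measure K).prod (ν : Measure K)) by simp]
  refine tendsto_integral_of_dominated_convergence (fun p => dist p.1 p.2 ^ 2) (fun n => ?_)
    (integrable_of_continuous (by fun_prop) _) (fun n => ae_of_all _ fun p => ?_)
    (ae_of_all _ fun p => ?_)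
  · exact Measurable.aestronglyMeasurable (by fun_prop)
  · have h1 : 0 ≤ dist p.1 p.2 ^ 2 / ((n : ℝ) + 2) := by positivity
    have h2 := Real.log_nonneg (show 1 ≤ 1 + dist p.1 p.2 ^ 2 / ((n : ℝ) + 2) by linarith)
    have h3 := Real.log_le_sub_one_of_pos
      (show 0 < 1 + dist p.1 p.2 ^ 2 / ((n : ℝ) + 2) by positivity)
    have h4 : dist p.1 p.2 ^ 2 / ((n : ℝ) + 2) ≤ dist p.1 p.2 ^ 2 :=
      div_le_self (by positivity) (by linarith [(Nat.cast_nonneg n : (0 : ℝ) ≤ n)])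
    rw [Real.norm_eq_abs, abs_mul, abs_of_nonneg h2, abs_neg, abs_of_pos (by norm_num : (0:ℝ) < 1/2)]
    linarith
  · have h1 : Tendsto (fun n : ℕ => 1 + dist p.1 p.2 ^ 2 / ((n : ℝ) + 2)) atTop (𝓝 (1 + 0)) :=
      (tendsto_const_nhds.div_atTop (tendsto_atTop_add_const_right _ _
        tendsto_natCast_atTop_atTop)).const_add 1
    have h2 := (h1.log (by norm_num)).const_mul (-(1 / 2))
    simpa using h2

/-- Each μ_i - ν_i has total mass zero, so additive constants in the kernel are invisible. This
allows the divergent ½ log δ to be added. -/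
lemma kernelForm_differenceMatrix_add_const (C : Matrix (Fin d) (Fin d) ℝ)
    {μ ν : Fin d → FiniteMeasure K} (hmass : ∀ i, (μ i).mass = (ν i).mass) {k : K × K → ℝ}
    (hk : Continuous k) (c : ℝ) :
    kernelForm (differenceMatrix C) (pairFamily μ ν) (fun p => k p + c) =
      kernelForm (differenceMatrix C) (pairFamily μ ν) k := by
  have hm : ∀ a, (pairFamily μ ν a).mass = (ν a.1).mass := fun a => by
    unfold pairFamily; split_ifs; exacts [hmass _, rfl]
  have h : ∀ a b, ∫ p, (k p + c) ∂((pairFamily μ ν a : Measure K).prod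
      (pairFamily μ ν b : Measure K)) =
      ∫ p, k p ∂((pairFamily μ ν a : Measure K).prod (pairFamily μ ν b : Measure K)) +
        (ν a.1).mass * (ν b.1).mass * c := fun a b => by
    rw [integral_add (integrable_of_continuous hk _) (integrable_const _), integral_const,
      smul_eq_mul]
    congr 2
    rw [← hm a, ← hm b, Measure.real, ← univ_prod_univ, Measure.prod_prod, ENNReal.toReal_mul]
    rfl
  unfold kernelForm
  simp only [h, mul_add, Finset.sum_add_distrib]
  rw [add_eq_left, sum_differenceMatrix C fun a b => ((ν a.1).mass : ℝ) * (ν b.1).mass * c]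
  simp

/-- The regularized energy of a difference of vectors of measures of equal masses is bounded below
by the energy gap. -/
lemma energyGap_le {C : Matrix (Fin d) (Fin d) ℝ} (hC : C.PosDef)
    {μ ν : Fin d → FiniteMeasure K} (hmass : ∀ i, (μ i).mass = (ν i).mass) (N : ℕ) :
    energyGap C μ ν ≤ ∑ i, ∑ j, C i j * (regEnergy N (μ i) (μ j) - regEnergy N (μ i) (ν j) -
      regEnergy N (ν i) (μ j) + regEnergy N (ν i) (ν j)) := by
  have hA := differenceMatrix_nonneg hC
  have hint : ∀ {ε : ℝ}, 0 < ε → ∀ a b, Integrable (regKernel ε)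
      ((pairFamily μ ν a : Measure K).prod (pairFamily μ ν b : Measure K)) :=
    fun hε a b => integrable_of_continuous (continuous_regKernel hε) _
  have hsum : ∑ i, ∑ j, C i j * (regEnergy N (μ i) (μ j) - regEnergy N (μ i) (ν j) -
      regEnergy N (ν i) (μ j) + regEnergy N (ν i) (ν j)) =
      kernelForm (differenceMatrix C) (pairFamily μ ν) (regKernel (1 / ((N : ℝ) + 1))) :=
    (sum_differenceMatrix C fun a b => ∫ p, regKernel (1 / ((N : ℝ) + 1)) p
      ∂((pairFamily μ ν a : Measure K).prod (pairFamily μ ν b : Measure K))).symm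
  -- Every regularization parameter lies below the scale 1 used in `energyGap`, so the bound is
  -- uniform in N.
  have hN : (1 : ℝ) / ((N : ℝ) + 1) ≤ 1 := by simpa using one_div_add_one_anti (Nat.zero_le N)
  have hle : ∀ {ε δ : ℝ}, 0 < ε → ε ≤ δ →
      kernelForm (differenceMatrix C) (pairFamily μ ν) (regKernel δ) ≤
      kernelForm (differenceMatrix C) (pairFamily μ ν) (regKernel ε) := fun hε h => by
    have := kernelForm_regKernel_sub_nonneg hA (pairFamily μ ν) hε h
    rw [kernelForm_sub _ _ (hint hε) (hint (hε.trans_le h))] at this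
    exact sub_nonneg.1 this
  have hlim : Tendsto (fun n : ℕ => kernelForm (differenceMatrix C) (pairFamily μ ν)
      (regKernel ((n : ℝ) + 2))) atTop (𝓝 0) := by
    have h : ∀ n : ℕ, kernelForm (differenceMatrix C) (pairFamily μ ν) (regKernel ((n : ℝ) + 2)) =
        kernelForm (differenceMatrix C) (pairFamily μ ν)
          (fun p => regKernel ((n : ℝ) + 2) p + 1 / 2 * Real.log ((n : ℝ) + 2)) := fun n =>
      (kernelForm_differenceMatrix_add_const C hmass (continuous_regKernel (by positivity)) _).symm
    simp only [h]
    unfold kernelForm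
    rw [show (0 : ℝ) = ∑ a, ∑ b, differenceMatrix C a b * 0 by simp]
    exact tendsto_finsetSum _ fun a _ => tendsto_finsetSum _ fun b _ =>
      (tendsto_integral_regKernel_add_log _ _).const_mul _
  -- The form decreases in the scale and tends to 0 at infinity, so it is nonnegative at scale 2.
  have h2 : 0 ≤ kernelForm (differenceMatrix C) (pairFamily μ ν) (regKernel 2) :=
    le_of_tendsto' hlim fun n => hle two_pos (by linarith [(Nat.cast_nonneg n : (0 : ℝ) ≤ n)])
  rw [hsum, energyGap, kernelForm_sub _ _ (hint one_pos) (hint two_pos)]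
  linarith [hle (by positivity) hN]

end Gap

/-! ### Semicontinuity, strict convexity and minimizers of J_V -/

section Functional

open Filter Topology

variable {E : Type*} [NormedAddCommGroup E] [InnerProductSpace ℝ E] [MeasurableSpace E]
  [BorelSpace E] [FiniteDimensional ℝ E] {K : Set E} [CompactSpace K] {d : ℕ}

/-- The regularized functional, with the potentials replaced by real functions. -/
noncomputable def regJV (C : Matrix (Fin d) (Fin d) ℝ) (f : Fin d → ℕ → K → ℝ) (N : ℕ)
    (μ : Fin d → FiniteMeasure K) : ℝ :=
  ∑ i, ∑ j, C i j * regEnergy N (μ i) (μ j) + ∑ i, ∫ x, f i N x ∂(μ i : Measure K)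

variable {C : Matrix (Fin d) (Fin d) ℝ} {f : Fin d → ℕ → K → ℝ} {V : Fin d → K → EReal}

lemma regJV_mono (hC : C.PosDef) (hf : ∀ i n, Continuous (f i n)) (hmono : ∀ i, Monotone (f i))
    (μ : Fin d → FiniteMeasure K) : Monotone fun N => regJV C f N μ := fun N M h =>
  add_le_add (sum_regEnergy_sub_nonneg hC.sum_sum_nonneg μ h)
    (Finset.sum_le_sum fun i _ => integral_mono (integrable_of_continuous (hf i N) _)
      (integrable_of_continuous (hf i M) _) (hmono i h))

lemma tendsto_regJV (hC : C.PosDef) (hf : ∀ i n, Continuous (f i n)) (hmono : ∀ i, Monotone (f i))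
    (hlim : ∀ i x, Tendsto (fun n => (f i n x : EReal)) atTop (𝓝 (V i x)))
    (μ : Fin d → FiniteMeasure K) :
    Tendsto (fun N => (regJV C f N μ : EReal)) atTop (𝓝 (energyJV C V μ)) := by
  have h1 := tendsto_energyJ0 hC μ
  have hV : ∀ i, Tendsto (fun n => ((∫ x, f i n x ∂(μ i : Measure K) : ℝ) : EReal)) atTop
      (𝓝 (extIntegral (μ i : Measure K) (V i))) := fun i =>
    tendsto_extIntegral (fun n => integrable_of_continuous (hf i n) _) (hmono i) (hlim i)
  have hVbot : ∀ i, extIntegral (μ i : Measure K) (V i) ≠ ⊥ := fun i =>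
    ((EReal.bot_lt_coe _).trans_le (Monotone.ge_of_tendsto (fun n m h => EReal.coe_le_coe_iff.2
      (integral_mono (integrable_of_continuous (hf i n) _)
      (integrable_of_continuous (hf i m) _) (hmono i h))) (hV i) 0)).ne'
  have h0bot : energyJ0 C μ ≠ ⊥ :=
    ((EReal.bot_lt_coe _).trans_le (Monotone.ge_of_tendsto (fun n m h => EReal.coe_le_coe_iff.2
      (sum_regEnergy_sub_nonneg hC.sum_sum_nonneg μ h)) h1 0)).ne'
  obtain ⟨h2, h2bot⟩ := EReal.tendsto_sum_of_ne_bot Finset.univ hVbot hV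
  simp only [regJV, EReal.coe_add, EReal.coe_sum_real Finset.univ
    fun i => ∫ x, f i _ x ∂(μ i : Measure K)]
  exact (EReal.continuousAt_add (p := (energyJ0 C μ, ∑ i, extIntegral (μ i : Measure K) (V i)))
    (Or.inr h2bot) (Or.inl h0bot)).tendsto.comp (h1.prodMk_nhds h2)

lemma continuousOn_regJV [Nonempty K] (hf : ∀ i n, Continuous (f i n)) (N : ℕ) :
    ContinuousOn (regJV C f N) {μ | ∀ i, μ i ≠ 0} := by
  intro μ hμ
  refine ContinuousAt.continuousWithinAt ?_
  unfold regJV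
  refine ContinuousAt.add ?_ ?_
  · refine tendsto_finsetSum _ fun i _ => tendsto_finsetSum _ fun j _ => ?_
    exact ((continuousAt_regEnergy (p := (μ i, μ j)) N (hμ i) (hμ j)).comp
      (f := fun μ : Fin d → FiniteMeasure K => (μ i, μ j)) (by fun_prop)).const_mul _
  · refine tendsto_finsetSum _ fun i _ => ?_
    exact ((FiniteMeasure.continuous_integral_continuousMap (⟨_, hf i N⟩ : C(K, ℝ))).comp
      (continuous_apply i)).continuousAt

/-- An increasing limit is a supremum, and a supremum of continuous functions is lower
semicontinuous. -/
lemma lowerSemicontinuousOn_energyJV [Nonempty K] (hC : C.PosDef)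
    (hf : ∀ i n, Continuous (f i n)) (hmono : ∀ i, Monotone (f i))
    (hlim : ∀ i x, Tendsto (fun n => (f i n x : EReal)) atTop (𝓝 (V i x))) :
    LowerSemicontinuousOn (energyJV C V) {μ | ∀ i, μ i ≠ 0} := by
  have h : energyJV C V = fun μ => ⨆ N, (regJV C f N μ : EReal) := funext fun μ =>
    tendsto_nhds_unique (tendsto_regJV hC hf hmono hlim μ)
      (tendsto_atTop_iSup fun n m h => EReal.coe_le_coe_iff.2 (regJV_mono hC hf hmono μ h))
  rw [h]
  exact lowerSemicontinuousOn_iSup fun N =>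
    (continuous_coe_real_ereal.comp_continuousOn (continuousOn_regJV hf N)).lowerSemicontinuousOn

/-- Exact parallelogram-type identity, from a² = a - ab and b² = b - ab; the potential terms are
affine. -/
lemma regJV_comb (hf : ∀ i n, Continuous (f i n)) (N : ℕ) (μ ν : Fin d → FiniteMeasure K)
    {a b : ℝ≥0} (hab : a + b = 1) :
    regJV C f N (a • μ + b • ν) = a * regJV C f N μ + b * regJV C f N ν -
      a * b * ∑ i, ∑ j, C i j * (regEnergy N (μ i) (μ j) - regEnergy N (μ i) (ν j) -
        regEnergy N (ν i) (μ j) + regEnergy N (ν i) (ν j)) := by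
  have hab' : (b : ℝ) = 1 - a := by
    have : (a : ℝ) + b = 1 := by exact_mod_cast hab
    linarith
  have hlin : ∀ i, ∫ x, f i N x ∂((a • μ i + b • ν i : FiniteMeasure K) : Measure K) =
      a * ∫ x, f i N x ∂(μ i : Measure K) + b * ∫ x, f i N x ∂(ν i : Measure K) := fun i => by
    rw [FiniteMeasure.toMeasure_add, integral_add_measure (integrable_of_continuous (hf i N) _)
      (integrable_of_continuous (hf i N) _), FiniteMeasure.toMeasure_smul,
      FiniteMeasure.toMeasure_smul, integral_smul_nnreal_measure, integral_smul_nnreal_measure]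
    rfl
  have hquad : ∑ i, ∑ j, C i j * regEnergy N (a • μ i + b • ν i) (a • μ j + b • ν j) =
      a * (∑ i, ∑ j, C i j * regEnergy N (μ i) (μ j)) +
        b * (∑ i, ∑ j, C i j * regEnergy N (ν i) (ν j)) -
        a * b * ∑ i, ∑ j, C i j * (regEnergy N (μ i) (μ j) - regEnergy N (μ i) (ν j) -
          regEnergy N (ν i) (μ j) + regEnergy N (ν i) (ν j)) := by
    simp only [Finset.mul_sum, ← Finset.sum_add_distrib, ← Finset.sum_sub_distrib]
    refine Finset.sum_congr rfl fun i _ => Finset.sum_congr rfl fun j _ => ?_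
    rw [regEnergy_comb, hab']
    ring
  simp only [regJV, Pi.add_apply, Pi.smul_apply, hquad, hlin, Finset.sum_add_distrib,
    ← Finset.mul_sum]
  ring

lemma energyJV_ne_bot (hC : C.PosDef) (hf : ∀ i n, Continuous (f i n))
    (hmono : ∀ i, Monotone (f i))
    (hlim : ∀ i x, Tendsto (fun n => (f i n x : EReal)) atTop (𝓝 (V i x)))
    (μ : Fin d → FiniteMeasure K) : energyJV C V μ ≠ ⊥ :=
  ((EReal.bot_lt_coe _).trans_le (Monotone.ge_of_tendsto (fun _ _ h => EReal.coe_le_coe_iff.2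
    (regJV_mono hC hf hmono μ h)) (tendsto_regJV hC hf hmono hlim μ) 0)).ne'

/-- Quantitative strict convexity of the energy functional. -/
lemma energyJV_comb_le (hC : C.PosDef) (hf : ∀ i n, Continuous (f i n))
    (hmono : ∀ i, Monotone (f i))
    (hlim : ∀ i x, Tendsto (fun n => (f i n x : EReal)) atTop (𝓝 (V i x)))
    {μ ν : Fin d → FiniteMeasure K} (hmass : ∀ i, (μ i).mass = (ν i).mass)
    (hμ : energyJV C V μ < ⊤) (hν : energyJV C V ν < ⊤) {a b : ℝ≥0} (hab : a + b = 1) :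
    energyJV C V (a • μ + b • ν) ≤ ((a * (energyJV C V μ).toReal + b * (energyJV C V ν).toReal -
      a * b * energyGap C μ ν : ℝ) : EReal) := by
  have hle : ∀ ρ : Fin d → FiniteMeasure K, energyJV C V ρ < ⊤ → ∀ N,
      regJV C f N ρ ≤ (energyJV C V ρ).toReal := fun ρ hρ N => by
    rw [← EReal.coe_le_coe_iff, EReal.coe_toReal hρ.ne (energyJV_ne_bot hC hf hmono hlim ρ)]
    exact Monotone.ge_of_tendsto (fun _ _ h => EReal.coe_le_coe_iff.2
      (regJV_mono hC hf hmono ρ h)) (tendsto_regJV hC hf hmono hlim ρ) N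
  -- The comparison is made between real numbers at each N, with a gap independent of N, and only
  -- then passed to the limit.
  refine le_of_tendsto' (tendsto_regJV hC hf hmono hlim _) fun N => EReal.coe_le_coe_iff.2 ?_
  rw [regJV_comb hf N μ ν hab]
  have h1 := mul_le_mul_of_nonneg_left (hle μ hμ N) a.coe_nonneg
  have h2 := mul_le_mul_of_nonneg_left (hle ν hν N) b.coe_nonneg
  have h3 := mul_le_mul_of_nonneg_left (energyGap_le hC hmass N) (by positivity : (0:ℝ) ≤ a * b)
  linarith

lemma convex_vectorMeasures (m : Fin d → ℝ≥0) : Convex ℝ≥0 (vectorMeasures K m) := by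
  intro μ hμ ν hν a b _ _ hab i
  have h1 : (μ i).mass = m i := hμ i
  have h2 : (ν i).mass = m i := hν i
  change (a • μ i + b • ν i) univ = m i
  rw [FiniteMeasure.coeFn_add, FiniteMeasure.coeFn_smul, FiniteMeasure.coeFn_smul]
  change a * (μ i).mass + b * (ν i).mass = m i
  rw [h1, h2, ← add_mul, hab, one_mul]

lemma isCompact_vectorMeasures (m : Fin d → ℝ≥0) : IsCompact (vectorMeasures K m) := by
  have h := isCompact_univ_pi fun i => isCompact_setOfPred_finiteMeasure_eq_of_compactSpace K (m i)
  convert h using 1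
  ext μ
  simp [vectorMeasures, measuresOfMass]

lemma strictConvexOn_energyJV (hC : C.PosDef) (hK : MeasurableSet K)
    (hf : ∀ i n, Continuous (f i n)) (hmono : ∀ i, Monotone (f i))
    (hlim : ∀ i x, Tendsto (fun n => (f i n x : EReal)) atTop (𝓝 (V i x))) (m : Fin d → ℝ≥0) :
    StrictConvexOn ℝ≥0 {μ | μ ∈ vectorMeasures K m ∧ energyJV C V μ < ⊤}
      (fun μ => (energyJV C V μ).toReal) := by
  have hmass : ∀ {μ ν : Fin d → FiniteMeasure K}, μ ∈ vectorMeasures K m →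
      ν ∈ vectorMeasures K m → ∀ i, (μ i).mass = (ν i).mass := fun hμ hν i =>
    (show _ = m i from hμ i).trans (show _ = m i from hν i).symm
  refine ⟨fun μ hμ ν hν a b ha hb hab => ⟨convex_vectorMeasures m hμ.1 hν.1 ha hb hab, ?_⟩,
    fun μ hμ ν hν hne a b ha hb hab => ?_⟩
  · exact (energyJV_comb_le hC hf hmono hlim (hmass hμ.1 hν.1) hμ.2 hν.2 hab).trans_lt
      (EReal.coe_lt_top _)
  · have h := energyJV_comb_le hC hf hmono hlim (hmass hμ.1 hν.1) hμ.2 hν.2 hab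
    have h2 := EReal.toReal_le_toReal h (energyJV_ne_bot hC hf hmono hlim _) (EReal.coe_ne_top _)
    rw [EReal.toReal_coe] at h2
    have h3 : (0 : ℝ) < a * b * energyGap C μ ν :=
      mul_pos (mul_pos (NNReal.coe_pos.2 ha) (NNReal.coe_pos.2 hb)) (energyGap_pos hC hne hK)
    refine h2.trans_lt ?_
    simp only [NNReal.smul_def, smul_eq_mul]
    linarith

lemma existsUnique_isMinOn_energyJV [Nonempty K] (hC : C.PosDef) (hK : MeasurableSet K)
    (hf : ∀ i n, Continuous (f i n)) (hmono : ∀ i, Monotone (f i))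
    (hlim : ∀ i x, Tendsto (fun n => (f i n x : EReal)) atTop (𝓝 (V i x))) {m : Fin d → ℝ≥0}
    (hm : ∀ i, 0 < m i) {S : Set (Fin d → FiniteMeasure K)} (hS : S ⊆ vectorMeasures K m)
    (hcomp : IsCompact S) (hconv : Convex ℝ≥0 S) (hfin : ∃ μ ∈ S, energyJV C V μ < ⊤) :
    ∃! μ, μ ∈ S ∧ IsMinOn (energyJV C V) S μ := by
  obtain ⟨ρ, hρS, hρ⟩ := hfin
  have hne : S ⊆ {μ | ∀ i, μ i ≠ 0} := fun μ hμ i h0 => by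
    have : (μ i).mass = m i := hS hμ i
    rw [h0, FiniteMeasure.zero_mass] at this
    exact (hm i).ne this
  obtain ⟨μ, hμS, hμ⟩ := LowerSemicontinuousOn.exists_isMinOn ⟨ρ, hρS⟩ hcomp
    ((lowerSemicontinuousOn_energyJV hC hf hmono hlim).mono hne)
  refine ⟨μ, ⟨hμS, hμ⟩, fun ν hν => ?_⟩
  by_contra hνμ
  have hsc := strictConvexOn_energyJV hC hK hf hmono hlim m
  have hμfin : energyJV C V μ < ⊤ := (hμ hρS).trans_lt hρ
  have hνfin : energyJV C V ν < ⊤ := (hν.2 hρS).trans_lt hρ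
  have hhalf : (1 / 2 : ℝ≥0) + 1 / 2 = 1 := add_halves 1
  -- Two distinct minimizers would have a midpoint in `S` of strictly smaller energy.
  have hmid := hsc.2 ⟨hS hν.1, hνfin⟩ ⟨hS hμS, hμfin⟩ hνμ one_half_pos one_half_pos hhalf
  have hmidS : (1 / 2 : ℝ≥0) • ν + (1 / 2 : ℝ≥0) • μ ∈ S :=
    hconv hν.1 hμS one_half_pos.le one_half_pos.le hhalf
  have hmidfin := (hsc.1 ⟨hS hν.1, hνfin⟩ ⟨hS hμS, hμfin⟩ one_half_pos.le one_half_pos.le hhalf).2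
  have hbot := energyJV_ne_bot hC hf hmono hlim (V := V) (C := C)
  have h1 := EReal.toReal_le_toReal (hμ hmidS) (hbot _) hmidfin.ne
  have h2 := EReal.toReal_le_toReal (hν.2 hμS) (hbot _) hμfin.ne
  simp only [NNReal.smul_def, smul_eq_mul] at hmid
  push_cast at hmid
  linarith

end Functional

/-! ### Finite-energy competitors from positive capacity -/

section FiniteEnergy

open Filter Topology

variable {E : Type*} [NormedAddCommGroup E] [InnerProductSpace ℝ E] [MeasurableSpace E]
  [BorelSpace E] [FiniteDimensional ℝ E] {K : Set E} [CompactSpace K]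

/-- All regularized kernels are at least the minimum r of the one of index 0. Restriction decreases
the integral of kernel minus r ≥ 0, and the correction involves only r and masses, not N. -/
lemma exists_regEnergy_restrict_le [Nonempty K] (μ : FiniteMeasure K) (A : Set K) :
    ∃ c : ℝ, ∀ N, regEnergy N (μ.restrict A) (μ.restrict A) ≤ regEnergy N μ μ + c := by
  obtain ⟨p₀, -, hp₀⟩ := isCompact_univ.exists_isMinOn univ_nonempty
    (continuous_regKernel_nat (X := K) 0).continuousOn
  set r := regKernel (1 / (((0 : ℕ) : ℝ) + 1)) p₀
  have hr : ∀ (N : ℕ) p, 0 ≤ regKernel (X := K) (1 / ((N : ℝ) + 1)) p - r := fun N p =>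
    sub_nonneg.2 ((hp₀ (mem_univ p)).trans (monotone_regKernel (Nat.zero_le N) p))
  let P := (μ : Measure K).prod (μ : Measure K)
  refine ⟨r * P.real (A ×ˢ A) - r * P.real univ, fun N => ?_⟩
  have h := setIntegral_le_integral (s := A ×ˢ A) (((integrable_regKernel N μ μ).sub
    (integrable_const r))) (ae_of_all _ (hr N))
  simp only [Pi.sub_apply] at h
  rw [integral_sub (integrable_regKernel N μ μ) (integrable_const r),
    integral_sub (integrable_regKernel N μ μ).integrableOn (integrable_const r), integral_const,
    integral_const] at h
  have h2 : regEnergy N (μ.restrict A) (μ.restrict A) =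
      ∫ p in A ×ˢ A, regKernel (1 / ((N : ℝ) + 1)) p ∂P := by
    unfold regEnergy
    rw [← Measure.prod_restrict]; rfl
  have h3 : regEnergy N μ μ = ∫ p, regKernel (1 / ((N : ℝ) + 1)) p ∂P := rfl
  simp only [smul_eq_mul, measureReal_restrict_apply_univ] at h
  rw [h2, h3]
  linarith

/-- A lower semicontinuous function finite on a set of positive capacity is integrable for some
measure of finite energy and prescribed mass. -/
lemma exists_finite_energy {V : K → EReal} (hV : LowerSemicontinuous V) (hbot : ∀ x, V x ≠ ⊥)
    (hcap : HasPositiveCapacity {x | V x < ⊤}) (m : ℝ≥0) :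
    ∃ μ : FiniteMeasure K, μ.mass = m ∧ logEnergy μ < ⊤ ∧
      extIntegral (μ : Measure K) V < ⊤ := by
  obtain ⟨F, hF, -, μ, hμ0, hμF, hμ⟩ := hcap
  obtain ⟨f, hf, hmono, hlim⟩ := hV.exists_monotone_tendsto hbot
  -- The sublevel sets of `V` at integer heights cover `F`, so one of them is charged by μ.
  -- Restricting μ to it bounds `V`, and rescaling prescribes the mass.
  obtain ⟨L, hL⟩ : ∃ L : ℕ, (μ : Measure K) {x | V x ≤ ((L : ℝ) : EReal)} ≠ 0 := by
    by_contra! h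
    have h1 : (μ : Measure K) F = 0 := by
      refine measure_mono_null (fun x hx => ?_) (measure_iUnion_null h)
      obtain ⟨r, hr, -⟩ := EReal.lt_iff_exists_real_btwn.1 (show V x < ⊤ from hF hx)
      obtain ⟨L, hL⟩ := exists_nat_ge r
      exact mem_iUnion.2 ⟨L, hr.le.trans (EReal.coe_le_coe_iff.2 hL)⟩
    refine hμ0 (FiniteMeasure.toMeasure_injective ?_)
    have h2 : (μ : Measure K) univ = 0 := by
      rw [← union_compl_self F]; exact measure_union_null h1 hμF
    simpa using h2
  set A := {x | V x ≤ ((L : ℝ) : EReal)} with hAdef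
  have hA : MeasurableSet A := (hV.isClosed_preimage ((L : ℝ) : EReal)).measurableSet
  have : Nonempty K := by
    by_contra hK
    rw [not_nonempty_iff] at hK
    exact hL (by rw [Set.eq_empty_of_isEmpty A]; simp)
  obtain ⟨c, hc⟩ := exists_regEnergy_restrict_le μ A
  set ν := μ.restrict A
  have hν : ν.mass ≠ 0 := by
    rw [FiniteMeasure.mass_nonzero_iff, FiniteMeasure.restrict_nonzero_iff]
    exact fun h => hL ((FiniteMeasure.null_iff_toMeasure_null μ A).1 h)
  set t : ℝ≥0 := m / ν.mass
  have hmass : (t • ν).mass = m := by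
    change (t • ν) univ = m
    rw [FiniteMeasure.coeFn_smul]
    exact div_mul_cancel₀ m hν
  refine ⟨t • ν, hmass, ?_, ?_⟩
  · have hle : ∀ N, regEnergy N (t • ν) (t • ν) ≤ t * (t * ((logEnergy μ).toReal + c)) := fun N => by
      rw [regEnergy_smul_left, regEnergy_comm, regEnergy_smul_left]
      have h1 : regEnergy N μ μ ≤ (logEnergy μ).toReal := by
        rw [← EReal.coe_le_coe_iff, EReal.coe_toReal hμ.ne (mutualEnergy_ne_bot μ μ)]
        exact regEnergy_le_mutualEnergy N μ μ
      have h2 := hc N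
      gcongr
      linarith
    exact (le_of_tendsto' (tendsto_regEnergy (t • ν) (t • ν)) fun N =>
      EReal.coe_le_coe_iff.2 (hle N)).trans_lt (EReal.coe_lt_top _)
  · have hint : ∀ n, Integrable (f n) ((t • ν : FiniteMeasure K) : Measure K) :=
      fun n => integrable_of_continuous (hf n) _
    have hae : ∀ᵐ x ∂((t • ν : FiniteMeasure K) : Measure K), x ∈ A := by
      rw [FiniteMeasure.toMeasure_smul]
      exact Measure.ae_smul_measure (ae_restrict_mem hA) t
    have hle : ∀ n, ∫ x, f n x ∂((t • ν : FiniteMeasure K) : Measure K) ≤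
        ∫ x, (L : ℝ) ∂((t • ν : FiniteMeasure K) : Measure K) := fun n => by
      refine integral_mono_ae (hint n) (integrable_const _) ?_
      filter_upwards [hae] with x hx
      refine EReal.coe_le_coe_iff.1 (le_trans ?_ hx)
      exact Monotone.ge_of_tendsto (fun i j h => EReal.coe_le_coe_iff.2 (hmono h x)) (hlim x) n
    exact (le_of_tendsto' (tendsto_extIntegral hint hmono hlim) fun n =>
      EReal.coe_le_coe_iff.2 (hle n)).trans_lt (EReal.coe_lt_top _)

lemma energyJV_lt_top {d : ℕ} (C : Matrix (Fin d) (Fin d) ℝ) {V : Fin d → K → EReal}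
    {μ : Fin d → FiniteMeasure K} (hμ : ∀ i, logEnergy (μ i) < ⊤)
    (hV : ∀ i, extIntegral (μ i : Measure K) (V i) < ⊤) : energyJV C V μ < ⊤ := by
  have h0 : energyJ0 C μ < ⊤ := by
    have hI : ∀ i j, (((mutualEnergy (μ i) (μ j)).toReal : ℝ) : EReal) = mutualEnergy (μ i) (μ j) :=
      fun i j => EReal.coe_toReal (mutualEnergy_lt_top (hμ i) (hμ j)).ne (mutualEnergy_ne_bot _ _)
    unfold energyJ0
    rw [if_pos hμ]
    refine EReal.sum_lt_top _ fun i => EReal.sum_lt_top _ fun j => ?_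
    rw [← hI, ← EReal.coe_mul]
    exact EReal.coe_lt_top _
  exact EReal.add_lt_top h0.ne (EReal.sum_lt_top _ hV).ne

end FiniteEnergy

theorem theorem3 (d n : ℕ) (_hd : 1 ≤ d) (_hn : 1 ≤ n)
    (K : Set (EuclideanSpace ℝ (Fin n))) (_hK : IsCompact K)
    (C : Matrix (Fin d) (Fin d) ℝ) (_hC : C.PosDef)
    (V : Fin d → K → EReal) (_hVbot : ∀ i x, V i x ≠ ⊥)
    (_hVlsc : ∀ i, LowerSemicontinuous (V i))
    (_hVcap : ∀ i, HasPositiveCapacity {x | V i x < ⊤})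
    (m : Fin d → ℝ≥0) (_hm : ∀ i, 0 < m i) :
    IsCompact (vectorMeasures K m) ∧
    (∀ μ ∈ vectorMeasures K m, energyJV C V μ ≠ ⊥) ∧
    LowerSemicontinuousOn (energyJV C V) (vectorMeasures K m) ∧
    StrictConvexOn ℝ≥0 {μ | μ ∈ vectorMeasures K m ∧ energyJV C V μ < ⊤}
      (fun μ => (energyJV C V μ).toReal) ∧
    (∃! μ, μ ∈ vectorMeasures K m ∧ IsMinOn (energyJV C V) (vectorMeasures K m) μ) ∧
    (∀ S : Set (Fin d → FiniteMeasure K), S ⊆ vectorMeasures K m → IsClosed S →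
      Convex ℝ≥0 S → (∃ μ ∈ S, energyJV C V μ < ⊤) →
      ∃! μ, μ ∈ S ∧ IsMinOn (energyJV C V) S μ) := by
  have : CompactSpace K := isCompact_iff_compactSpace.1 _hK
  choose f hf hmono hlim using fun i => (_hVlsc i).exists_monotone_tendsto (_hVbot i)
  choose ρ hρm hρI hρV using fun i => exists_finite_energy (_hVlsc i) (_hVbot i) (_hVcap i) (m i)
  have hne : vectorMeasures K m ⊆ {μ | ∀ i, μ i ≠ 0} := fun μ hμ i h0 => by
    have : (μ i).mass = m i := hμ i
    rw [h0, FiniteMeasure.zero_mass] at this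
    exact (_hm i).ne this
  -- On an empty `K` every measure is zero, contradicting the positive mass of `ρ` at index 0, which
  -- exists because d ≥ 1.
  have : Nonempty K := by
    by_contra hK
    rw [not_nonempty_iff] at hK
    exact hne hρm ⟨0, _hd⟩ (FiniteMeasure.toMeasure_injective (Subsingleton.elim _ _))
  have hcomp := isCompact_vectorMeasures (K := K) m
  refine ⟨hcomp, fun μ _ => energyJV_ne_bot _hC hf hmono hlim μ,
    (lowerSemicontinuousOn_energyJV _hC hf hmono hlim).mono hne,
    strictConvexOn_energyJV _hC _hK.measurableSet hf hmono hlim m,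
    existsUnique_isMinOn_energyJV _hC _hK.measurableSet hf hmono hlim _hm subset_rfl hcomp
      (convex_vectorMeasures m) ⟨ρ, hρm, energyJV_lt_top C hρI hρV⟩,
    fun S hS hcl hconv hfin => existsUnique_isMinOn_energyJV _hC _hK.measurableSet hf hmono hlim
      _hm hS (hcomp.of_isClosed_subset hcl hS) hconv hfin⟩
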